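/- Corollary 5.4 (Ambarzumyan). Let $J=\begin{pmatrix}0&1\\-1&0\end{pmatrix}$, $\sigma_0=\mathbb I=\begin{pmatrix}1&0\\0&1\end{pmatrix}$ and $\sigma_2=iJ=\begin{pmatrix}0&i\\-i&0\end{pmatrix}$. Let $Q:\mathbb R\to M_2(\mathbb C)$ be integrable on $[0,\pi)$ (entrywise, for Lebesgue measure) and such that $Q(x)$ is Hermitian and $Q(x+\pi)=Q(x)$ for almost every $x\in\mathbb R$. For $\lambda\in\mathbb C$ let $\mathbb Y(\cdot,\lambda):\mathbb R\to M_2(\mathbb C)$ be the unique locally absolutely continuous matrix function with $$J\,\mathbb Y'(x)+Q(x)\,\mathbb Y(x)=\lambda\,\mathbb Y(x)\quad\text{for almost every }x\in\mathbb R,\qquad \mathbb Y(0)=\mathbb I,$$ and let $\Delta(\lambda)=\operatorname{tr}\mathbb Y(\pi,\lambda)$ be the discriminant. Put $\mathcal S=\{\lambda\in\mathbb R:|\Delta(\lambda)|\le 2\}$; the instability intervals are the connected components of $\mathbb R\setminus\mathcal S$. Then every instability interval vanishes (that is, there is none: $\mathcal S=\mathbb R$) if and only if there are real-valued functions $r,q$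 on $\mathbb R$, integrable on $[0,\pi)$, such that $$Q(x)=r(x)\,\sigma_0+q(x)\,\sigma_2\quad\text{for almost every }x\in\mathbb R.$$ -/

import Mathlib

open MeasureTheory

namespace DiracSystem

/-- The symplectic matrix `J` of the expression `ℓ Y = J Y' + Q Y`. -/
def J : Matrix (Fin 2) (Fin 2) ℂ := !![0, 1; -1, 0]

/-- The Pauli matrix `σ₀`, the identity. -/
def sigma0 : Matrix (Fin 2) (Fin 2) ℂ := 1

/-- The Pauli matrix `σ₂`, with the sign convention `σ₂ = i J`. -/
def sigma2 : Matrix (Fin 2) (Fin 2) ℂ := !![0, Complex.I; -Complex.I, 0]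

/-- `Y` is the fundamental matrix of `J Y' + Q Y = lam Y` on the real line normalized by
`Y 0 = 1`: its entries are locally absolutely continuous, and the equation holds for almost
every `x` (where all the entries are differentiable, since they are absolutely continuous). -/
structure IsFundamentalMatrix (Q : ℝ → Matrix (Fin 2) (Fin 2) ℂ) (lam : ℂ)
    (Y : ℝ → Matrix (Fin 2) (Fin 2) ℂ) : Prop where
  initial : Y 0 = 1
  absolutelyContinuous : ∀ (i j : Fin 2) (a b : ℝ),
    AbsolutelyContinuousOnInterval (fun x => Y x i j) a b
  equation : ∀ᵐ x : ℝ, J * (Matrix.of fun i j => deriv (fun t => Y t i j) x) + Q x * Y x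
    = lam • Y x

/-- `d` is the value `Δ(lam)` of the discriminant, that is, the trace `y₁₁(π) + y₂₂(π)` of the
(unique) normalized fundamental matrix at `π`. -/
def IsDiscriminant (Q : ℝ → Matrix (Fin 2) (Fin 2) ℂ) (lam d : ℂ) : Prop :=
  ∃ Y : ℝ → Matrix (Fin 2) (Fin 2) ℂ,
    IsFundamentalMatrix Q lam Y ∧ d = (Y Real.pi).trace

/-- The set `{lam ∈ ℝ : |Δ(lam)| ≤ 2}`. -/
def stabilitySet (Q : ℝ → Matrix (Fin 2) (Fin 2) ℂ) : Set ℝ :=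
  {lam | ∃ d : ℂ, IsDiscriminant Q (lam : ℂ) d ∧ ‖d‖ ≤ 2}

/-- The instability intervals: the connected components of the complement in `ℝ` of
`stabilitySet Q`. -/
def instabilityIntervals (Q : ℝ → Matrix (Fin 2) (Fin 2) ℂ) : Set (Set ℝ) :=
  {I | ∃ lam ∈ (stabilitySet Q)ᶜ, I = connectedComponentIn (stabilitySet Q)ᶜ lam}

/-- Every instability interval vanishes. A component of a set is never empty, so this says that
there is none. -/
def AllInstabilityIntervalsVanish (Q : ℝ → Matrix (Fin 2) (Fin 2) ℂ) : Prop :=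
  instabilityIntervals Q = ∅

end DiracSystem

/-
In the eigenbasis of `J`, and after a gauge transformation that removes the coefficient of `σ₂`, the
equation becomes the Zakharov–Shabat system `u' = i (r - lam) u + g v`,
`v' = conj g u - i (r - lam) v`, where `g` is the traceless real symmetric part of `Q`. For the
solution with initial value `(1, 0)` one has `|u|² - |v|² = 1` and `|Δ(lam)| = 2 |Re u(π, lam)|`. If
`g = 0`, then `|Re u(π, lam)| = |cos (π lam - ∫ r)| ≤ 1`.

Suppose that `g` does not vanish almost everywhere and write `u(π, lam) = R exp (-i ψ)` with
`R ≥ 1`. As functions of `lam`, the phase `ψ` is strictly increasing, with `ψ = π lam - ∫ r + o(1)`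
at `±∞` by the Riemann–Lebesgue lemma, and `f = R cos ψ` moves with speed `|f'| > π √(1 - f²)`
wherever `|f| ≤ 1` and `sin ψ ≠ 0`. If `|f| ≤ 1` everywhere, then `f = ±1` at the nodes `ψ = k π`,
and comparison with the cosine of frequency `π` puts consecutive nodes `l k` and `l (k + 1)` less
than `1` apart. So `l k - k` is strictly decreasing in `k`, although it has the same limit at both
ends, which is absurd.
-/

namespace DiracSystem

open Set Filter Topology ComplexConjugate

section AbsoluteContinuity

variable {X Z : Type*} [PseudoMetricSpace X] [PseudoMetricSpace Z]

theorem absolutelyContinuousOnInterval_of_dist_le {u : ℝ → X} {w : ℝ → Z} {K a b : ℝ}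
    (hw : AbsolutelyContinuousOnInterval w a b)
    (h : ∀ x ∈ uIcc a b, ∀ y ∈ uIcc a b, dist (u x) (u y) ≤ K * dist (w x) (w y)) :
    AbsolutelyContinuousOnInterval u a b := by
  have hKw := Tendsto.const_mul K hw
  rw [mul_zero] at hKw
  refine squeeze_zero' (.of_forall fun _ => Finset.sum_nonneg fun _ _ => dist_nonneg) ?_ hKw
  rw [eventually_inf_principal]
  refine .of_forall fun E hE => ?_
  rw [Finset.mul_sum]
  exact Finset.sum_le_sum fun i hi => h _ (hE.1 i hi).1 _ (hE.1 i hi).2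

theorem absolutelyContinuousOnInterval_comp_of_lipschitzOnWith {φ : Z → X} {K : NNReal}
    {s : Set Z} {w : ℝ → Z} {a b : ℝ} (hφ : LipschitzOnWith K φ s)
    (hw : AbsolutelyContinuousOnInterval w a b) (hs : MapsTo w (uIcc a b) s) :
    AbsolutelyContinuousOnInterval (fun x => φ (w x)) a b :=
  absolutelyContinuousOnInterval_of_dist_le hw fun _ hx _ hy =>
    hφ.dist_le_mul _ (hs hx) _ (hs hy)

theorem absolutelyContinuousOnInterval_clm_comp {E F : Type*} [NormedAddCommGroup E]
    [NormedSpace ℝ E] [NormedAddCommGroup F] [NormedSpace ℝ F] (L : E →L[ℝ] F) {u : ℝ → E}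
    {a b : ℝ} (hu : AbsolutelyContinuousOnInterval u a b) :
    AbsolutelyContinuousOnInterval (fun x => L (u x)) a b :=
  absolutelyContinuousOnInterval_comp_of_lipschitzOnWith
    (L.lipschitz.lipschitzOnWith (s := univ)) hu (mapsTo_univ _ _)

theorem absolutelyContinuousOnInterval_intervalIntegral {E : Type*} [NormedAddCommGroup E]
    [NormedSpace ℝ E] {f : ℝ → E} {a b c : ℝ} (hf : IntervalIntegrable f volume a b)
    (hc : c ∈ uIcc a b) : AbsolutelyContinuousOnInterval (fun x => ∫ t in c..x, f t) a b := by
  refine absolutelyContinuousOnInterval_of_dist_le (K := 1)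
    (hf.norm.absolutelyContinuousOnInterval_intervalIntegral hc) fun x hx y hy => ?_
  have hfrom : ∀ z ∈ uIcc a b, IntervalIntegrable f volume c z := fun z hz =>
    hf.mono_set (uIcc_subset_uIcc hc hz)
  rw [one_mul, dist_eq_norm, Real.dist_eq,
    intervalIntegral.integral_interval_sub_left (hfrom x hx) (hfrom y hy),
    intervalIntegral.integral_interval_sub_left (hfrom x hx).norm (hfrom y hy).norm]
  exact intervalIntegral.norm_integral_le_abs_integral_norm

end AbsoluteContinuity

/-- `u : ℝ → ℂ` is absolutely continuous on `[a, b]`, with derivative `u'` almost everywhere. The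
derivative is a parameter, so that the rules of calculus give it in closed form. -/
structure HasACDeriv (u u' : ℝ → ℂ) (a b : ℝ) : Prop where
  ac : AbsolutelyContinuousOnInterval u a b
  hasDerivAt : ∀ᵐ x : ℝ, x ∈ uIcc a b → HasDerivAt u (u' x) x

theorem hasACDeriv_deriv {u : ℝ → ℂ} {a b : ℝ} (hu : AbsolutelyContinuousOnInterval u a b) :
    HasACDeriv u (deriv u) a b := by
  have hre := absolutelyContinuousOnInterval_clm_comp Complex.reCLM hu
  have him := absolutelyContinuousOnInterval_clm_comp Complex.imCLM hu
  refine ⟨hu, ?_⟩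
  filter_upwards [hre.ae_differentiableAt, him.ae_differentiableAt] with x hx₁ hx₂ hx
  have hdiff := (hx₁ hx).hasDerivAt.ofReal_comp.add
    ((hx₂ hx).hasDerivAt.ofReal_comp.mul_const Complex.I)
  refine DifferentiableAt.hasDerivAt ?_
  convert! hdiff.differentiableAt using 1
  ext y
  simp [Complex.re_add_im]

namespace HasACDeriv

variable {u v u' v' : ℝ → ℂ} {a b : ℝ}

theorem congr_deriv (hu : HasACDeriv u u' a b) (h : ∀ᵐ x : ℝ, x ∈ uIcc a b → u' x = v' x) :
    HasACDeriv u v' a b := by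
  refine ⟨hu.ac, ?_⟩
  filter_upwards [hu.hasDerivAt, h] with x hx heq hmem using heq hmem ▸ hx hmem

theorem mono {c d : ℝ} (hu : HasACDeriv u u' a b) (h : uIcc c d ⊆ uIcc a b) :
    HasACDeriv u u' c d := by
  refine ⟨hu.ac.mono h, ?_⟩
  filter_upwards [hu.hasDerivAt] with x hx hmem using hx (h hmem)

theorem of_hasDerivAt (h : ∀ x, HasDerivAt u (u' x) x) (hc : Continuous u') :
    HasACDeriv u u' a b := by
  refine ⟨ContDiffOn.absolutelyContinuousOnInterval ?_, .of_forall fun x _ => h x⟩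
  refine (contDiff_one_iff_deriv.2 ⟨fun x => (h x).differentiableAt, ?_⟩).contDiffOn
  rwa [show deriv u = u' from funext fun x => (h x).deriv]

theorem add (hu : HasACDeriv u u' a b) (hv : HasACDeriv v v' a b) :
    HasACDeriv (fun x => u x + v x) (fun x => u' x + v' x) a b := by
  refine ⟨hu.ac.fun_add hv.ac, ?_⟩
  filter_upwards [hu.hasDerivAt, hv.hasDerivAt] with x hux hvx hmem using (hux hmem).add (hvx hmem)

theorem sub (hu : HasACDeriv u u' a b) (hv : HasACDeriv v v' a b) :
    HasACDeriv (fun x => u x - v x) (fun x => u' x - v' x) a b := by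
  refine ⟨hu.ac.fun_sub hv.ac, ?_⟩
  filter_upwards [hu.hasDerivAt, hv.hasDerivAt] with x hux hvx hmem using (hux hmem).sub (hvx hmem)

theorem mul (hu : HasACDeriv u u' a b) (hv : HasACDeriv v v' a b) :
    HasACDeriv (fun x => u x * v x) (fun x => u' x * v x + u x * v' x) a b := by
  refine ⟨hu.ac.fun_smul hv.ac, ?_⟩
  filter_upwards [hu.hasDerivAt, hv.hasDerivAt] with x hux hvx hmem using (hux hmem).mul (hvx hmem)

theorem const_mul (c : ℂ) (hu : HasACDeriv u u' a b) :
    HasACDeriv (fun x => c * u x) (fun x => c * u' x) a b := by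
  refine ⟨hu.ac.const_smul c, ?_⟩
  filter_upwards [hu.hasDerivAt] with x hx hmem using (hx hmem).const_mul c

theorem conjugate (hu : HasACDeriv u u' a b) :
    HasACDeriv (fun x => conj (u x)) (fun x => conj (u' x)) a b := by
  refine ⟨absolutelyContinuousOnInterval_clm_comp Complex.conjCLE.toContinuousLinearMap hu.ac, ?_⟩
  filter_upwards [hu.hasDerivAt] with x hx hmem using (hx hmem).star

theorem continuousOn (hu : HasACDeriv u u' a b) : ContinuousOn u (uIcc a b) :=
  hu.ac.continuousOn

theorem comp {φ φ' : ℂ → ℂ} {U : Set ℂ} (hU : IsOpen U)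
    (hφ : ∀ z ∈ U, HasDerivAt φ (φ' z) z) (hu : HasACDeriv u u' a b)
    (hmem : MapsTo u (uIcc a b) U) :
    HasACDeriv (fun x => φ (u x)) (fun x => φ' (u x) * u' x) a b := by
  have hdiff : DifferentiableOn ℂ φ U := fun z hz =>
    (hφ z hz).differentiableAt.differentiableWithinAt
  have hlip : LocallyLipschitzOn (u '' uIcc a b) φ := by
    rintro _ ⟨x, hx, rfl⟩
    have hsmooth : ContDiffAt ℂ 1 φ (u x) :=
      (hdiff.analyticAt (hU.mem_nhds (hmem hx))).contDiffAt
    obtain ⟨K, t, ht, hK⟩ := hsmooth.exists_lipschitzOnWith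
    exact ⟨K, t, mem_nhdsWithin_of_mem_nhds ht, hK⟩
  obtain ⟨K, hK⟩ :=
    hlip.exists_lipschitzOnWith_of_compact (isCompact_uIcc.image_of_continuousOn hu.continuousOn)
  refine ⟨absolutelyContinuousOnInterval_comp_of_lipschitzOnWith hK hu.ac (mapsTo_image _ _), ?_⟩
  filter_upwards [hu.hasDerivAt] with x hx hx' using (hφ _ (hmem hx')).comp x (hx hx')

theorem cexp (hu : HasACDeriv u u' a b) :
    HasACDeriv (fun x => Complex.exp (u x)) (fun x => Complex.exp (u x) * u' x) a b :=
  hu.comp isOpen_univ (fun z _ => Complex.hasDerivAt_exp z) (mapsTo_univ _ _)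

theorem div (hu : HasACDeriv u u' a b) (hv : HasACDeriv v v' a b)
    (hne : ∀ x ∈ uIcc a b, v x ≠ 0) :
    HasACDeriv (fun x => u x / v x) (fun x => (u' x * v x - u x * v' x) / v x ^ 2) a b := by
  have hinv := hv.comp isOpen_ne (fun z hz => hasDerivAt_inv hz) hne
  refine (hu.mul hinv).congr_deriv (.of_forall fun x hx => ?_)
  have := hne x hx
  field_simp
  ring

theorem intervalIntegral {f : ℝ → ℂ} {c : ℝ} (hf : IntervalIntegrable f volume a b)
    (hc : c ∈ uIcc a b) : HasACDeriv (fun x => ∫ t in c..x, f t) f a b := by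
  refine ⟨absolutelyContinuousOnInterval_intervalIntegral hf hc, ?_⟩
  filter_upwards [hf.ae_hasDerivAt_integral] with x hx hmem using hx hmem c hc

theorem ofReal_intervalIntegral {f : ℝ → ℝ} {c : ℝ} (hf : IntervalIntegrable f volume a b)
    (hc : c ∈ uIcc a b) :
    HasACDeriv (fun x => ((∫ t in c..x, f t : ℝ) : ℂ)) (fun x => (f x : ℂ)) a b := by
  simpa only [intervalIntegral.integral_ofReal] using
    intervalIntegral (f := fun x => (f x : ℂ)) ⟨hf.1.ofReal, hf.2.ofReal⟩ hc

theorem intervalIntegrable (hu : HasACDeriv u u' a b) : IntervalIntegrable u' volume a b := by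
  have hre := absolutelyContinuousOnInterval_clm_comp Complex.reCLM hu.ac
  have him := absolutelyContinuousOnInterval_clm_comp Complex.imCLM hu.ac
  have hre' := hre.intervalIntegrable_deriv
  have him' := him.intervalIntegrable_deriv
  refine IntervalIntegrable.congr_ae (f := fun x => ((deriv (fun y => (u y).re) x : ℝ) : ℂ)
    + ((deriv (fun y => (u y).im) x : ℝ) : ℂ) * Complex.I) ?_ ?_
  · exact IntervalIntegrable.add ⟨hre'.1.ofReal, hre'.2.ofReal⟩
      (IntervalIntegrable.mul_const ⟨him'.1.ofReal, him'.2.ofReal⟩ _)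
  · refine (ae_restrict_iff' measurableSet_uIoc).2 ?_
    filter_upwards [hu.hasDerivAt] with x hx hmem
    have hux := hx (uIoc_subset_uIcc hmem)
    have hrex : HasDerivAt (fun y => (u y).re) (u' x).re x :=
      Complex.reCLM.hasFDerivAt.comp_hasDerivAt x hux
    have himx : HasDerivAt (fun y => (u y).im) (u' x).im x :=
      Complex.imCLM.hasFDerivAt.comp_hasDerivAt x hux
    rw [hrex.deriv, himx.deriv, Complex.re_add_im]

theorem eqOn_const_of_deriv_eq_zero (hu : HasACDeriv u u' a b)
    (h : ∀ᵐ x : ℝ, x ∈ uIcc a b → u' x = 0) : ∀ x ∈ uIcc a b, u x = u a := by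
  obtain ⟨C, hC⟩ := hu.ac.const_of_ae_hasDerivAt_zero (by
    filter_upwards [hu.hasDerivAt, h] with x hx hzero hmem using hzero hmem ▸ hx hmem)
  intro x hx
  rw [hC x hx, hC a left_mem_uIcc]

theorem eq_add_integral (hu : HasACDeriv u u' a b) : ∀ x ∈ uIcc a b,
    u x = u a + ∫ t in a..x, u' t := by
  intro x hx
  have h := (hu.sub (intervalIntegral hu.intervalIntegrable
    left_mem_uIcc)).eqOn_const_of_deriv_eq_zero (by simp) x hx
  simp only [intervalIntegral.integral_same, sub_zero] at h
  rw [← h, sub_add_cancel]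

end HasACDeriv

section Oscillation

theorem mul_sub_lt_pi_of_deriv_lt {f f' : ℝ → ℝ} {T l m : ℝ} (hlm : l < m)
    (hf : ∀ x, HasDerivAt f (f' x) x) (hl : f l = 1) (hm : f m = -1)
    (hlt : ∀ x ∈ Ioo l m, |f x| < 1)
    (hf' : ∀ x ∈ Ioo l m, f' x < -(T * √(1 - f x ^ 2))) :
    T * (m - l) < Real.pi := by
  have hcont : Continuous f := continuous_iff_continuousAt.2 fun x => (hf x).continuousAt
  have hderiv : ∀ x ∈ Ioo l m, HasDerivAt (fun x => Real.arccos (f x) - T * x)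
      (-(1 / √(1 - f x ^ 2)) * f' x - T * 1) x := fun x hx => by
    have hx' := abs_lt.1 (hlt x hx)
    exact ((Real.hasDerivAt_arccos hx'.1.ne' hx'.2.ne).comp x (hf x)).sub
      ((hasDerivAt_id x).const_mul T)
  have hmono : StrictMonoOn (fun x => Real.arccos (f x) - T * x) (Icc l m) := by
    refine strictMonoOn_of_deriv_pos (convex_Icc l m) (by fun_prop) fun x hx => ?_
    rw [interior_Icc] at hx
    have hsqrt : 0 < √(1 - f x ^ 2) :=
      Real.sqrt_pos.2 (by linarith [(sq_lt_one_iff_abs_lt_one _).2 (hlt x hx)])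
    have hT : T < -f' x / √(1 - f x ^ 2) := by
      rw [lt_div_iff₀ hsqrt]
      linarith [hf' x hx]
    rw [(hderiv x hx).deriv]
    calc 0 < -f' x / √(1 - f x ^ 2) - T := sub_pos.2 hT
      _ = _ := by ring
  have h := hmono (left_mem_Icc.2 hlm.le) (right_mem_Icc.2 hlm.le) hlm
  simp only [hl, hm, Real.arccos_one, Real.arccos_neg_one] at h
  linarith

theorem abs_lt_one_of_deriv_ne_zero {f : ℝ → ℝ} {f' x : ℝ} (hf : ∀ y, |f y| ≤ 1)
    (hd : HasDerivAt f f' x) (hne : f' ≠ 0) : |f x| < 1 := by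
  refine (hf x).lt_of_ne fun h => hne ?_
  rcases eq_or_eq_neg_of_abs_eq h with h | h
  · exact IsLocalMax.hasDerivAt_eq_zero (.of_forall fun y => h ▸ (abs_le.1 (hf y)).2) hd
  · exact IsLocalMin.hasDerivAt_eq_zero (.of_forall fun y => h ▸ (abs_le.1 (hf y)).1) hd

theorem exists_phase_nodes {ψ : ℝ → ℝ} {T c : ℝ} (hT : 0 < T) (hmono : StrictMono ψ)
    (hcont : Continuous ψ) (htop : Tendsto (fun x => ψ x - (T * x - c)) atTop (𝓝 0))
    (hbot : Tendsto (fun x => ψ x - (T * x - c)) atBot (𝓝 0)) :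
    ∃ l : ℤ → ℝ, (∀ k, ψ (l k) = k * Real.pi) ∧
      Tendsto (fun k => T * l k - k * Real.pi) atTop (𝓝 c) ∧
      Tendsto (fun k => T * l k - k * Real.pi) atBot (𝓝 c) := by
  have hψtop : Tendsto ψ atTop atTop := by
    simpa [← sub_eq_add_neg] using htop.add_atTop
      (tendsto_atTop_add_const_right _ (-c) (tendsto_id.const_mul_atTop hT))
  have hψbot : Tendsto ψ atBot atBot := by
    simpa [← sub_eq_add_neg] using hbot.add_atBot
      (tendsto_atBot_add_const_right _ (-c) (tendsto_id.const_mul_atBot hT))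
  let e : ℝ ≃o ℝ := hmono.orderIsoOfSurjective ψ (hcont.surjective hψtop hψbot)
  have he : ∀ y, ψ (e.symm y) = y := e.apply_symm_apply
  have hlim {F : Filter ℝ} {G : Filter ℤ} (h : Tendsto (fun x => ψ x - (T * x - c)) F (𝓝 0))
      (hl : Tendsto (fun k : ℤ => e.symm (k * Real.pi)) G F) :
      Tendsto (fun k : ℤ => T * e.symm (k * Real.pi) - k * Real.pi) G (𝓝 c) := by
    have h := (h.comp hl).const_sub c
    simp only [Function.comp_def, he, sub_zero] at h
    exact h.congr fun k => by ring
  refine ⟨fun k => e.symm (k * Real.pi), fun k => he _, hlim htop ?_, hlim hbot ?_⟩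
  · exact e.symm.tendsto_atTop.comp (tendsto_intCast_atTop_atTop.atTop_mul_const Real.pi_pos)
  · exact e.symm.tendsto_atBot.comp
      ((tendsto_intCast_atBot_iff.2 tendsto_id).atBot_mul_const Real.pi_pos)

variable {f f' R ψ : ℝ → ℝ} {T c : ℝ}

theorem eq_cos_of_phase_eq_int_mul_pi {x : ℝ} {k : ℤ} (hfR : f x = R x * Real.cos (ψ x))
    (hR : 1 ≤ R x) (hf : |f x| ≤ 1) (hψ : ψ x = k * Real.pi) : f x = Real.cos (k * Real.pi) := by
  rw [hψ] at hfR
  have hRx : R x = 1 := by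
    refine le_antisymm ?_ hR
    rwa [hfR, abs_mul, Real.abs_cos_int_mul_pi, mul_one, abs_of_nonneg (by linarith)] at hf
  rw [hfR, hRx, one_mul]

theorem mul_node_sub_lt_pi {k : ℤ} {l m : ℝ} (hf : ∀ x, HasDerivAt f (f' x) x)
    (hfR : ∀ x, f x = R x * Real.cos (ψ x)) (hR : ∀ x, 1 ≤ R x) (hmono : StrictMono ψ)
    (hspeed : ∀ x, Real.sin (ψ x) ≠ 0 →
      f' x * Real.sin (ψ x) < 0 ∧ T * √(1 - f x ^ 2) < |f' x|)
    (hle : ∀ x, |f x| ≤ 1) (hl : ψ l = k * Real.pi) (hm : ψ m = (k + 1) * Real.pi) :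
    T * (m - l) < Real.pi := by
  set σ := Real.cos (k * Real.pi)
  have hσabs : |σ| = 1 := Real.abs_cos_int_mul_pi k
  have hσsq : σ * σ = 1 := by rw [← abs_mul_abs_self σ, hσabs, one_mul]
  have hfl : f l = σ := eq_cos_of_phase_eq_int_mul_pi (hfR l) (hR l) (hle l) hl
  have hfm : f m = -σ := by
    rw [eq_cos_of_phase_eq_int_mul_pi (k := k + 1) (hfR m) (hR m) (hle m) (by simpa using hm)]
    push_cast
    rw [add_mul, one_mul, Real.cos_add_pi]
  have hsin : ∀ x ∈ Ioo l m, 0 < σ * Real.sin (ψ x) := fun x hx => by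
    have hlx := hmono hx.1
    have hxm := hmono hx.2
    have h : 0 < Real.sin (ψ x - k * Real.pi) :=
      Real.sin_pos_of_pos_of_lt_pi (by linarith) (by linarith)
    rw [Real.sin_sub, Real.sin_int_mul_pi] at h
    linarith
  have hspeed' : ∀ x ∈ Ioo l m, f' x * Real.sin (ψ x) < 0 ∧ T * √(1 - f x ^ 2) < |f' x| :=
    fun x hx => hspeed x (right_ne_zero_of_mul (hsin x hx).ne')
  have hlm : l < m := hmono.lt_iff_lt.1 (by linarith [Real.pi_pos])
  refine mul_sub_lt_pi_of_deriv_lt (f := fun x => σ * f x) hlm (fun x => (hf x).const_mul σ)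
    (by rw [hfl, hσsq]) (by rw [hfm, mul_neg, hσsq]) (fun x hx => ?_) fun x hx => ?_
  · rw [abs_mul, hσabs, one_mul]
    exact abs_lt_one_of_deriv_ne_zero hle (hf x) (left_ne_zero_of_mul (hspeed' x hx).1.ne)
  · have hneg : σ * f' x < 0 := by
      refine neg_of_mul_neg_left (b := σ * Real.sin (ψ x)) ?_ (hsin x hx).le
      calc σ * f' x * (σ * Real.sin (ψ x)) = σ * σ * (f' x * Real.sin (ψ x)) := by ring
        _ < 0 := by rw [hσsq, one_mul]; exact (hspeed' x hx).1
    have habs : |f' x| = -(σ * f' x) := by rw [← abs_of_neg hneg, abs_mul, hσabs, one_mul]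
    rw [mul_pow, sq σ, hσsq, one_mul]
    linarith [(hspeed' x hx).2]

theorem exists_one_lt_abs_of_phase_asymptotic (hT : 0 < T) (hf : ∀ x, HasDerivAt f (f' x) x)
    (hfR : ∀ x, f x = R x * Real.cos (ψ x)) (hR : ∀ x, 1 ≤ R x) (hmono : StrictMono ψ)
    (hcont : Continuous ψ) (htop : Tendsto (fun x => ψ x - (T * x - c)) atTop (𝓝 0))
    (hbot : Tendsto (fun x => ψ x - (T * x - c)) atBot (𝓝 0))
    (hspeed : ∀ x, |f x| ≤ 1 → Real.sin (ψ x) ≠ 0 →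
      f' x * Real.sin (ψ x) < 0 ∧ T * √(1 - f x ^ 2) < |f' x|) :
    ∃ x, 1 < |f x| := by
  by_contra! hle
  obtain ⟨l, hl, hltop, hlbot⟩ := exists_phase_nodes hT hmono hcont htop hbot
  have hanti : StrictAnti fun k : ℤ => T * l k - k * Real.pi := by
    refine strictAnti_int_of_succ_lt fun k => ?_
    have := mul_node_sub_lt_pi hf hfR hR hmono (fun x => hspeed x (hle x)) hle (hl k)
      (by simpa using hl (k + 1))
    push_cast
    linarith
  exact (hanti zero_lt_one).not_ge
    ((hanti.antitone.ge_of_tendsto hlbot 0).trans (hanti.antitone.le_of_tendsto hltop 1))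

end Oscillation

/-- `(u, v)` solves on `[0, T]` the Zakharov–Shabat form of the Dirac system,
`u' = i (r - lam) u + g v`, `v' = conj g u - i (r - lam) v`. Here `r` is the coefficient of `σ₀` in
the potential, `g` its traceless real symmetric part, and the coefficient of `σ₂` has been
gauged away. -/
structure IsSolution (r : ℝ → ℝ) (g : ℝ → ℂ) (lam T : ℝ) (u v : ℝ → ℂ) : Prop where
  fst : HasACDeriv u (fun x => Complex.I * (r x - lam) * u x + g x * v x) 0 T
  snd : HasACDeriv v (fun x => conj (g x) * u x - Complex.I * (r x - lam) * v x) 0 T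

/-- The solution of the Zakharov–Shabat system with initial value `(1, 0)`. -/
structure IsNormalizedSolution (r : ℝ → ℝ) (g : ℝ → ℂ) (lam T : ℝ) (u v : ℝ → ℂ) : Prop
    extends IsSolution r g lam T u v where
  fst_zero : u 0 = 1
  snd_zero : v 0 = 0

variable {r : ℝ → ℝ} {g : ℝ → ℂ} {T : ℝ}

namespace IsSolution

variable {lam₀ lam : ℝ} {p q u v : ℝ → ℂ}

theorem hasACDeriv_hermitianPairing (h₀ : IsSolution r g lam₀ T p q)
    (h : IsSolution r g lam T u v) :
    HasACDeriv (fun x => conj (p x) * u x - conj (q x) * v x)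
      (fun x => -(Complex.I * (lam - lam₀)) * (conj (p x) * u x + conj (q x) * v x)) 0 T := by
  refine ((h₀.fst.conjugate.mul h.fst).sub (h₀.snd.conjugate.mul h.snd)).congr_deriv
    (.of_forall fun x _ => ?_)
  simp only [map_add, map_sub, map_mul, Complex.conj_I, Complex.conj_ofReal, Complex.conj_conj]
  ring

theorem hasACDeriv_wronskian (h₀ : IsSolution r g lam₀ T p q) (h : IsSolution r g lam T u v) :
    HasACDeriv (fun x => p x * v x - q x * u x)
      (fun x => Complex.I * (lam - lam₀) * (p x * v x + q x * u x)) 0 T :=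
  ((h₀.fst.mul h.snd).sub (h₀.snd.mul h.fst)).congr_deriv (.of_forall fun x _ => by ring)

end IsSolution

namespace IsNormalizedSolution

variable {lam₀ lam : ℝ} {p q u v : ℝ → ℂ}

theorem restrict (h : IsNormalizedSolution r g lam T u v) {x : ℝ} (hx : x ∈ uIcc 0 T) :
    IsNormalizedSolution r g lam x u v :=
  have hsub := uIcc_subset_uIcc left_mem_uIcc hx
  ⟨⟨h.fst.mono hsub, h.snd.mono hsub⟩, h.fst_zero, h.snd_zero⟩

theorem conj_mul_sub_conj_mul (h : IsNormalizedSolution r g lam T u v) {x : ℝ}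
    (hx : x ∈ uIcc 0 T) : conj (u x) * u x - conj (v x) * v x = 1 := by
  have hconst := (h.hasACDeriv_hermitianPairing h.toIsSolution).eqOn_const_of_deriv_eq_zero
    (.of_forall fun t _ => by ring) x hx
  simpa [h.fst_zero, h.snd_zero] using hconst

theorem norm_sq_sub_norm_sq (h : IsNormalizedSolution r g lam T u v) {x : ℝ} (hx : x ∈ uIcc 0 T) :
    ‖u x‖ ^ 2 - ‖v x‖ ^ 2 = 1 := by
  have hid := h.conj_mul_sub_conj_mul hx
  rw [Complex.conj_mul', Complex.conj_mul'] at hid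
  exact_mod_cast hid

theorem one_le_norm_fst (h : IsNormalizedSolution r g lam T u v) {x : ℝ} (hx : x ∈ uIcc 0 T) :
    1 ≤ ‖u x‖ := by
  nlinarith [h.norm_sq_sub_norm_sq hx, norm_nonneg (u x), sq_nonneg ‖v x‖]

theorem fst_ne_zero (h : IsNormalizedSolution r g lam T u v) {x : ℝ} (hx : x ∈ uIcc 0 T) :
    u x ≠ 0 :=
  norm_pos_iff.1 (zero_lt_one.trans_le (h.one_le_norm_fst hx))

theorem norm_snd_lt_norm_fst (h : IsNormalizedSolution r g lam T u v) {x : ℝ}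
    (hx : x ∈ uIcc 0 T) : ‖v x‖ < ‖u x‖ :=
  lt_of_pow_lt_pow_left₀ 2 (norm_nonneg _) (by linarith [h.norm_sq_sub_norm_sq hx])

theorem norm_div_le_one (h : IsNormalizedSolution r g lam T u v) {x : ℝ} (hx : x ∈ uIcc 0 T) :
    ‖v x / u x‖ ≤ 1 := by
  rw [norm_div]
  exact div_le_one_of_le₀ (h.norm_snd_lt_norm_fst hx).le (norm_nonneg _)

theorem eq_transfer (h₀ : IsNormalizedSolution r g lam₀ T p q) (a b : ℂ) {x : ℝ}
    (hx : x ∈ uIcc 0 T) :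
    a = p x * (conj (p x) * a - conj (q x) * b) + conj (q x) * (p x * b - q x * a) ∧
      b = q x * (conj (p x) * a - conj (q x) * b) + conj (p x) * (p x * b - q x * a) := by
  have hid := h₀.conj_mul_sub_conj_mul hx
  constructor
  · linear_combination -a * hid
  · linear_combination -b * hid

theorem snd_eq_of_isSolution (h : IsNormalizedSolution r g lam T u v)
    (h' : IsSolution r g lam T p q) {x : ℝ} (hx : x ∈ uIcc 0 T) :
    q x = v x * p 0 + conj (u x) * q 0 := by
  have hpair := (h.hasACDeriv_hermitianPairing h').eqOn_const_of_deriv_eq_zero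
    (.of_forall fun t _ => by ring) x hx
  have hwron := (h.hasACDeriv_wronskian h').eqOn_const_of_deriv_eq_zero
    (.of_forall fun t _ => by ring) x hx
  simp only [h.fst_zero, h.snd_zero, map_one, map_zero, one_mul, zero_mul, sub_zero]
    at hpair hwron
  rw [(h.eq_transfer (p x) (q x) hx).2, hpair, hwron]

theorem hasACDeriv_ratio (h : IsNormalizedSolution r g lam T u v) :
    HasACDeriv (fun x => v x / u x) (fun x => conj (g x) - 2 * Complex.I * (r x - lam) * (v x / u x)
      - g x * (v x / u x) ^ 2) 0 T := by
  refine (h.snd.div h.fst fun x hx => h.fst_ne_zero hx).congr_deriv (.of_forall fun x hx => ?_)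
  have := h.fst_ne_zero hx
  field_simp
  ring

end IsNormalizedSolution

/-- The phase `lam x - ∫₀ˣ r` that the system accumulates on `[0, x]` in the absence of the
coupling `g`. -/
noncomputable def freePhase (r : ℝ → ℝ) (lam x : ℝ) : ℝ := lam * x - ∫ t in (0 : ℝ)..x, r t

/-- The correction `∫₀ˣ g v / u` that the coupling `g` makes to the logarithm of `u`. -/
noncomputable def couplingLog (g u v : ℝ → ℂ) (x : ℝ) : ℂ :=
  ∫ t in (0 : ℝ)..x, g t * (v t / u t)

theorem hasACDeriv_freePhase {a b : ℝ} (hr : IntervalIntegrable r volume a b)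
    (h₀ : 0 ∈ uIcc a b) (lam : ℝ) :
    HasACDeriv (fun x => (freePhase r lam x : ℂ)) (fun x => lam - r x) a b := by
  have hlin : HasACDeriv (fun x : ℝ => (lam : ℂ) * x) (fun _ => lam) a b :=
    .of_hasDerivAt (fun x => by simpa using (hasDerivAt_id x).ofReal_comp.const_mul (lam : ℂ))
      continuous_const
  simpa [freePhase] using hlin.sub (.ofReal_intervalIntegral hr h₀)

namespace IsNormalizedSolution

variable {lam : ℝ} {u v : ℝ → ℂ}

theorem intervalIntegrable_mul_ratio (h : IsNormalizedSolution r g lam T u v)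
    (hg : IntervalIntegrable g volume 0 T) :
    IntervalIntegrable (fun t => g t * (v t / u t)) volume 0 T :=
  hg.mul_continuousOn h.hasACDeriv_ratio.continuousOn

theorem exp_couplingLog_sub_freePhase (h : IsNormalizedSolution r g lam T u v)
    (hr : IntervalIntegrable r volume 0 T) (hg : IntervalIntegrable g volume 0 T) {x : ℝ}
    (hx : x ∈ uIcc 0 T) :
    Complex.exp (couplingLog g u v x - Complex.I * freePhase r lam x) = u x := by
  have hlog : HasACDeriv (fun x => couplingLog g u v x - Complex.I * freePhase r lam x)
      (fun x => g x * (v x / u x) - Complex.I * (lam - r x)) 0 T :=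
    HasACDeriv.sub (.intervalIntegral (h.intervalIntegrable_mul_ratio hg) left_mem_uIcc)
      ((hasACDeriv_freePhase hr left_mem_uIcc lam).const_mul _)
  have hconst := (hlog.cexp.div h.fst fun x hx => h.fst_ne_zero hx).eqOn_const_of_deriv_eq_zero
    (.of_forall fun t ht => by
      have := h.fst_ne_zero ht
      field_simp
      ring) x hx
  simpa [couplingLog, freePhase, h.fst_zero, div_eq_one_iff_eq (h.fst_ne_zero hx)] using hconst

theorem norm_fst_le (h : IsNormalizedSolution r g lam T u v) (hT : 0 ≤ T)
    (hr : IntervalIntegrable r volume 0 T) (hg : IntervalIntegrable g volume 0 T) :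
    ‖u T‖ ≤ Real.exp (∫ t in (0 : ℝ)..T, ‖g t‖) := by
  have hre : (couplingLog g u v T - Complex.I * freePhase r lam T).re
      = (couplingLog g u v T).re := by simp
  rw [← h.exp_couplingLog_sub_freePhase hr hg right_mem_uIcc, Complex.norm_exp, hre,
    Real.exp_le_exp]
  refine (Complex.re_le_norm _).trans ?_
  refine intervalIntegral.norm_integral_le_of_norm_le hT (.of_forall fun t ht => ?_) hg.norm
  rw [norm_mul]
  exact mul_le_of_le_one_right (norm_nonneg _)
    (h.norm_div_le_one (uIcc_of_le hT ▸ Ioc_subset_Icc_self ht))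

end IsNormalizedSolution

theorem tendsto_intervalIntegral_mul_exp_cocompact (f : ℝ → ℂ) (hT : 0 ≤ T) :
    Tendsto (fun lam : ℝ => ∫ t in (0 : ℝ)..T, f t * Complex.exp (2 * Complex.I * (lam * t)))
      (cocompact ℝ) (𝓝 0) := by
  have hRL := Real.tendsto_integral_exp_smul_cocompact (indicator (Ioc 0 T) f)
  have hscale : Tendsto (fun lam : ℝ => lam * (-Real.pi⁻¹)) (cocompact ℝ) (cocompact ℝ) :=
    (Homeomorph.mulRight₀ (-Real.pi⁻¹)
      (by simp [Real.pi_ne_zero])).isClosedEmbedding.tendsto_cocompact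
  refine (hRL.comp hscale).congr fun lam => ?_
  rw [Function.comp_apply, intervalIntegral.integral_of_le hT,
    ← integral_indicator measurableSet_Ioc]
  congr 1
  ext t
  by_cases ht : t ∈ Ioc 0 T
  · rw [indicator_of_mem ht, indicator_of_mem ht, Circle.smul_def, Real.fourierChar_apply,
      smul_eq_mul, mul_comm]
    congr 2
    push_cast
    field_simp
  · rw [indicator_of_notMem ht, indicator_of_notMem ht, smul_zero]

/-- The integral `∫₀ˣ g exp(2 i (lam t - ∫₀ᵗ r))`, the first Born approximation of
`couplingLog`. -/
noncomputable def bornIntegral (r : ℝ → ℝ) (g : ℝ → ℂ) (lam x : ℝ) : ℂ :=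
  ∫ t in (0 : ℝ)..x, g t * Complex.exp (2 * Complex.I * freePhase r lam t)

theorem norm_exp_two_mul_I_mul_ofReal (x : ℝ) : ‖Complex.exp (2 * Complex.I * x)‖ = 1 := by
  rw [show 2 * Complex.I * x = ((2 * x : ℝ) : ℂ) * Complex.I by push_cast; ring,
    Complex.norm_exp_ofReal_mul_I]

theorem tendsto_bornIntegral_cocompact (r : ℝ → ℝ) (g : ℝ → ℂ) (hT : 0 ≤ T) :
    Tendsto (fun lam => bornIntegral r g lam T) (cocompact ℝ) (𝓝 0) := by
  refine (tendsto_intervalIntegral_mul_exp_cocompact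
    (fun t => g t * Complex.exp (2 * Complex.I * freePhase r 0 t)) hT).congr fun lam => ?_
  refine intervalIntegral.integral_congr fun t _ => ?_
  simp only [freePhase, mul_assoc, ← Complex.exp_add]
  congr 2
  push_cast
  ring

theorem norm_bornIntegral_le (r : ℝ → ℝ) (g : ℝ → ℂ) (lam : ℝ) (hT : 0 ≤ T) :
    ‖bornIntegral r g lam T‖ ≤ ∫ t in (0 : ℝ)..T, ‖g t‖ := by
  refine (intervalIntegral.norm_integral_le_integral_norm hT).trans_eq ?_
  simp only [norm_mul, norm_exp_two_mul_I_mul_ofReal, mul_one]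

theorem hasACDeriv_exp_freePhase (hr : IntervalIntegrable r volume 0 T) (c : ℂ) (lam : ℝ) :
    HasACDeriv (fun x => Complex.exp (c * freePhase r lam x))
      (fun x => Complex.exp (c * freePhase r lam x) * (c * (lam - r x))) 0 T :=
  ((hasACDeriv_freePhase hr left_mem_uIcc lam).const_mul c).cexp

theorem hasACDeriv_bornIntegral (hr : IntervalIntegrable r volume 0 T)
    (hg : IntervalIntegrable g volume 0 T) (lam : ℝ) :
    HasACDeriv (bornIntegral r g lam)
      (fun t => g t * Complex.exp (2 * Complex.I * freePhase r lam t)) 0 T :=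
  .intervalIntegral (hg.mul_continuousOn (hasACDeriv_exp_freePhase hr _ lam).continuousOn)
    left_mem_uIcc

namespace IsNormalizedSolution

variable {lam : ℝ} {u v : ℝ → ℂ}

/- Integration by parts against `v / u`, whose Riccati equation has the integrable right-hand side
`conj g - g (v / u) ^ 2` once the free oscillation is removed. -/
theorem couplingLog_eq (h : IsNormalizedSolution r g lam T u v)
    (hr : IntervalIntegrable r volume 0 T) (hg : IntervalIntegrable g volume 0 T) :
    couplingLog g u v T =
      bornIntegral r g lam T * (v T / u T * Complex.exp (-(2 * Complex.I) * freePhase r lam T))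
      - ∫ x in (0 : ℝ)..T, bornIntegral r g lam x *
        ((conj (g x) - g x * (v x / u x) ^ 2) *
          Complex.exp (-(2 * Complex.I) * freePhase r lam x)) := by
  have hborn := hasACDeriv_bornIntegral hr hg lam
  have hriccati := (h.hasACDeriv_ratio.mul
    (hasACDeriv_exp_freePhase hr (-(2 * Complex.I)) lam)).congr_deriv
    (v' := fun x => (conj (g x) - g x * (v x / u x) ^ 2) *
      Complex.exp (-(2 * Complex.I) * freePhase r lam x)) (.of_forall fun x _ => by ring)
  have hparts := (hborn.mul hriccati).eq_add_integral T right_mem_uIcc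
  have hzero : bornIntegral r g lam 0 = 0 := intervalIntegral.integral_same
  rw [intervalIntegral.integral_add (hborn.intervalIntegrable.mul_continuousOn
    hriccati.continuousOn) (hriccati.intervalIntegrable.continuousOn_mul hborn.continuousOn),
    hzero, zero_mul, zero_add] at hparts
  rw [hparts, couplingLog, add_sub_cancel_right]
  refine intervalIntegral.integral_congr fun x _ => ?_
  have hexp : Complex.exp (2 * Complex.I * freePhase r lam x)
      * Complex.exp (-(2 * Complex.I) * freePhase r lam x) = 1 := by
    rw [← Complex.exp_add, neg_mul, add_neg_cancel, Complex.exp_zero]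
  linear_combination -(g x * (v x / u x)) * hexp

theorem norm_couplingLog_le (h : IsNormalizedSolution r g lam T u v) (hT : 0 ≤ T)
    (hr : IntervalIntegrable r volume 0 T) (hg : IntervalIntegrable g volume 0 T) :
    ‖couplingLog g u v T‖ ≤ ‖bornIntegral r g lam T‖
      + ∫ x in (0 : ℝ)..T, ‖bornIntegral r g lam x‖ * (2 * ‖g x‖) := by
  have hexp : ∀ x, ‖Complex.exp (-(2 * Complex.I) * freePhase r lam x)‖ = 1 := fun x => by
    rw [neg_mul, ← mul_neg, ← Complex.ofReal_neg, norm_exp_two_mul_I_mul_ofReal]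
  rw [h.couplingLog_eq hr hg]
  refine (norm_sub_le _ _).trans (add_le_add ?_ ?_)
  · rw [norm_mul, norm_mul, hexp, mul_one]
    exact mul_le_of_le_one_right (norm_nonneg _) (h.norm_div_le_one right_mem_uIcc)
  · refine intervalIntegral.norm_integral_le_of_norm_le hT (.of_forall fun x hx => ?_)
      ((hg.norm.const_mul 2).continuousOn_mul
        (hasACDeriv_bornIntegral hr hg lam).continuousOn.norm)
    rw [norm_mul, norm_mul, hexp, mul_one]
    refine mul_le_mul_of_nonneg_left ((norm_sub_le _ _).trans ?_) (norm_nonneg _)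
    rw [RCLike.norm_conj, norm_mul, norm_pow, two_mul]
    refine add_le_add_right (mul_le_of_le_one_right (norm_nonneg _) ?_) _
    exact pow_le_one₀ (norm_nonneg _)
      (h.norm_div_le_one (uIcc_of_le hT ▸ Ioc_subset_Icc_self hx))

theorem tendsto_couplingLog_cocompact {u v : ℝ → ℝ → ℂ}
    (H : ∀ lam, IsNormalizedSolution r g lam T (u lam) (v lam)) (hT : 0 ≤ T)
    (hr : IntervalIntegrable r volume 0 T) (hg : IntervalIntegrable g volume 0 T) :
    Tendsto (fun lam => couplingLog g (u lam) (v lam) T) (cocompact ℝ) (𝓝 0) := by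
  have hborn : ∀ x, 0 ≤ x → Tendsto (fun lam => ‖bornIntegral r g lam x‖) (cocompact ℝ) (𝓝 0) :=
    fun x hx => by simpa using (tendsto_bornIntegral_cocompact r g hx).norm
  have hmono : ∀ x ∈ Ioc 0 T, ∫ t in (0 : ℝ)..x, ‖g t‖ ≤ ∫ t in (0 : ℝ)..T, ‖g t‖ := fun x hx =>
    intervalIntegral.integral_mono_interval le_rfl hx.1.le hx.2
      (.of_forall fun _ => norm_nonneg _) hg.norm
  have hdom : Tendsto (fun lam => ∫ x in (0 : ℝ)..T, ‖bornIntegral r g lam x‖ * (2 * ‖g x‖))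
      (cocompact ℝ) (𝓝 (∫ _ in (0 : ℝ)..T, (0 : ℝ))) := by
    have : (cocompact ℝ).IsCountablyGenerated := by
      rw [cocompact_eq_atBot_atTop]
      infer_instance
    refine intervalIntegral.tendsto_integral_filter_of_dominated_convergence
      (fun x => (∫ t in (0 : ℝ)..T, ‖g t‖) * (2 * ‖g x‖)) (.of_forall fun lam => ?_)
      (.of_forall fun lam => .of_forall fun x hx => ?_)
      ((hg.norm.const_mul 2).const_mul _) (.of_forall fun x hx => ?_)
    · exact ((hg.norm.const_mul 2).continuousOn_mul
        (hasACDeriv_bornIntegral hr hg lam).continuousOn.norm).def'.aestronglyMeasurable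
    · rw [uIoc_of_le hT] at hx
      rw [norm_mul, norm_norm, Real.norm_of_nonneg (by positivity : 0 ≤ 2 * ‖g x‖)]
      exact mul_le_mul_of_nonneg_right
        ((norm_bornIntegral_le r g lam hx.1.le).trans (hmono x hx)) (by positivity)
    · rw [uIoc_of_le hT] at hx
      simpa using (hborn x hx.1.le).mul_const (2 * ‖g x‖)
  rw [intervalIntegral.integral_zero] at hdom
  refine squeeze_zero_norm (fun lam => (H lam).norm_couplingLog_le hT hr hg) ?_
  simpa using (hborn T hT).add hdom

end IsNormalizedSolution

theorem hasDerivAt_sub_mul_of_continuousAt {N : ℝ → ℂ} {x₀ : ℝ} (hN : ContinuousAt N x₀) :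
    HasDerivAt (fun x : ℝ => ((x : ℂ) - x₀) * N x) (N x₀) x₀ := by
  rw [hasDerivAt_iff_tendsto_slope]
  refine (hN.tendsto.mono_left nhdsWithin_le_nhds).congr' ?_
  filter_upwards [self_mem_nhdsWithin] with x hx
  have hne : ((x : ℂ) - x₀) ≠ 0 := sub_ne_zero.2 (by exact_mod_cast hx)
  rw [slope_def_module, sub_self, zero_mul, sub_zero, Complex.real_smul]
  push_cast
  field_simp

theorem tendsto_sub_mul_of_norm_le {N : ℝ → ℂ} {x₀ C : ℝ} (hN : ∀ x, ‖N x‖ ≤ C) :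
    Tendsto (fun x : ℝ => ((x : ℂ) - x₀) * N x) (𝓝 x₀) (𝓝 0) := by
  have hzero : Tendsto (fun x : ℝ => (x : ℂ) - x₀) (𝓝 x₀) (𝓝 0) := by
    have hcont : Continuous fun x : ℝ => (x : ℂ) - x₀ := by fun_prop
    simpa using hcont.tendsto x₀
  exact hzero.zero_mul_isBoundedUnder_le (isBoundedUnder_of ⟨C, hN⟩)

theorem norm_mul_add_mul_le {a b c d : ℂ} {M : ℝ} (ha : ‖a‖ ≤ M) (hb : ‖b‖ ≤ M) (hc : ‖c‖ ≤ M)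
    (hd : ‖d‖ ≤ M) : ‖a * b + c * d‖ ≤ 2 * M ^ 2 := by
  have hM : 0 ≤ M := (norm_nonneg _).trans ha
  calc ‖a * b + c * d‖ ≤ ‖a‖ * ‖b‖ + ‖c‖ * ‖d‖ := by
        simpa only [norm_mul] using norm_add_le (a * b) (c * d)
    _ ≤ M * M + M * M := by gcongr
    _ = 2 * M ^ 2 := by ring

/-- `∫₀ᵀ (|u|² + |v|²)`, the coefficient of `-i u(T)` in the derivative of `u(T)` with respect to
the spectral parameter. -/
noncomputable def hermitianMoment (u v : ℝ → ℂ) (T : ℝ) : ℝ :=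
  ∫ t in (0 : ℝ)..T, (‖u t‖ ^ 2 + ‖v t‖ ^ 2)

/-- `∫₀ᵀ 2 u v`, the coefficient of `i conj v(T)` in the derivative of `u(T)` with respect to the
spectral parameter. -/
noncomputable def bilinearMoment (u v : ℝ → ℂ) (T : ℝ) : ℂ :=
  ∫ t in (0 : ℝ)..T, 2 * (u t * v t)

namespace IsNormalizedSolution

theorem eq_variation_of_parameters {lam₀ lam : ℝ} {p q u v : ℝ → ℂ}
    (h₀ : IsNormalizedSolution r g lam₀ T p q) (h : IsNormalizedSolution r g lam T u v) :
    u T = p T * (1 - Complex.I * ((lam - lam₀) *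
          ∫ t in (0 : ℝ)..T, (conj (p t) * u t + conj (q t) * v t)))
        + conj (q T) * (Complex.I * ((lam - lam₀) *
          ∫ t in (0 : ℝ)..T, (p t * v t + q t * u t))) ∧
      v T = q T * (1 - Complex.I * ((lam - lam₀) *
          ∫ t in (0 : ℝ)..T, (conj (p t) * u t + conj (q t) * v t)))
        + conj (p T) * (Complex.I * ((lam - lam₀) *
          ∫ t in (0 : ℝ)..T, (p t * v t + q t * u t))) := by
  have hpair := (h₀.hasACDeriv_hermitianPairing h.toIsSolution).eq_add_integral T right_mem_uIcc
  have hwron := (h₀.hasACDeriv_wronskian h.toIsSolution).eq_add_integral T right_mem_uIcc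
  rw [intervalIntegral.integral_const_mul] at hpair hwron
  simp only [h₀.fst_zero, h₀.snd_zero, h.fst_zero, h.snd_zero, map_one, map_zero, mul_one,
    mul_zero, sub_zero, zero_add, neg_mul, ← sub_eq_add_neg, mul_assoc] at hpair hwron
  rw [← hpair, ← hwron]
  exact h₀.eq_transfer (u T) (v T) right_mem_uIcc

section Family

variable {u v : ℝ → ℝ → ℂ}

theorem exists_norm_le (H : ∀ lam, IsNormalizedSolution r g lam T (u lam) (v lam)) (hT : 0 ≤ T)
    (hr : IntervalIntegrable r volume 0 T) (hg : IntervalIntegrable g volume 0 T) :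
    ∃ M, ∀ lam, ∀ x ∈ uIcc 0 T, ‖u lam x‖ ≤ M ∧ ‖v lam x‖ ≤ M := by
  refine ⟨Real.exp (∫ t in (0 : ℝ)..T, ‖g t‖), fun lam x hx => ?_⟩
  have hsub := uIcc_subset_uIcc left_mem_uIcc hx
  have hx' : x ∈ Icc 0 T := by rwa [← uIcc_of_le hT]
  have hu : ‖u lam x‖ ≤ Real.exp (∫ t in (0 : ℝ)..T, ‖g t‖) := by
    refine (((H lam).restrict hx).norm_fst_le hx'.1 (hr.mono_set hsub) (hg.mono_set hsub)).trans ?_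
    exact Real.exp_le_exp.2 (intervalIntegral.integral_mono_interval le_rfl hx'.1 hx'.2
      (.of_forall fun _ => norm_nonneg _) hg.norm)
  exact ⟨hu, ((H lam).norm_snd_lt_norm_fst hx).le.trans hu⟩

theorem continuous_parameter (H : ∀ lam, IsNormalizedSolution r g lam T (u lam) (v lam))
    (hT : 0 ≤ T) (hr : IntervalIntegrable r volume 0 T) (hg : IntervalIntegrable g volume 0 T) :
    (Continuous fun lam => u lam T) ∧ Continuous fun lam => v lam T := by
  obtain ⟨M, hM⟩ := exists_norm_le H hT hr hg
  simp only [continuous_iff_continuousAt, ContinuousAt, ← forall_and]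
  intro lam₀
  have hpair := (tendsto_sub_mul_of_norm_le (x₀ := lam₀)
    (N := fun lam => ∫ t in (0 : ℝ)..T,
      (conj (u lam₀ t) * u lam t + conj (v lam₀ t) * v lam t)) fun lam =>
    intervalIntegral.norm_integral_le_of_norm_le_const fun t ht => by
      have ht := uIoc_subset_uIcc ht
      exact norm_mul_add_mul_le (by simpa using (hM lam₀ t ht).1) (hM lam t ht).1
        (by simpa using (hM lam₀ t ht).2) (hM lam t ht).2).const_mul Complex.I |>.const_sub 1
  have hwron := (tendsto_sub_mul_of_norm_le (x₀ := lam₀)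
    (N := fun lam => ∫ t in (0 : ℝ)..T, (u lam₀ t * v lam t + v lam₀ t * u lam t)) fun lam =>
    intervalIntegral.norm_integral_le_of_norm_le_const fun t ht => by
      have ht := uIoc_subset_uIcc ht
      exact norm_mul_add_mul_le (hM lam₀ t ht).1 (hM lam t ht).2 (hM lam₀ t ht).2
        (hM lam t ht).1).const_mul Complex.I
  have hu := (hpair.const_mul (u lam₀ T)).add (hwron.const_mul (conj (v lam₀ T)))
  have hv := (hpair.const_mul (v lam₀ T)).add (hwron.const_mul (conj (u lam₀ T)))
  simp only [mul_zero, sub_zero, mul_one, add_zero] at hu hv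
  exact ⟨hu.congr fun lam => ((H lam₀).eq_variation_of_parameters (H lam)).1.symm,
    hv.congr fun lam => ((H lam₀).eq_variation_of_parameters (H lam)).2.symm⟩

theorem continuous_parameter_of_mem (H : ∀ lam, IsNormalizedSolution r g lam T (u lam) (v lam))
    (hT : 0 ≤ T) (hr : IntervalIntegrable r volume 0 T) (hg : IntervalIntegrable g volume 0 T)
    {x : ℝ} (hx : x ∈ uIcc 0 T) :
    (Continuous fun lam => u lam x) ∧ Continuous fun lam => v lam x :=
  have hsub := uIcc_subset_uIcc left_mem_uIcc hx
  continuous_parameter (fun lam => (H lam).restrict hx) (uIcc_of_le hT ▸ hx).1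
    (hr.mono_set hsub) (hg.mono_set hsub)

theorem continuous_integral_mul_add_mul
    (H : ∀ lam, IsNormalizedSolution r g lam T (u lam) (v lam)) (hT : 0 ≤ T)
    (hr : IntervalIntegrable r volume 0 T) (hg : IntervalIntegrable g volume 0 T) {a b : ℝ → ℂ}
    (ha : ContinuousOn a (uIcc 0 T)) (hb : ContinuousOn b (uIcc 0 T)) :
    Continuous fun lam => ∫ t in (0 : ℝ)..T, (a t * u lam t + b t * v lam t) := by
  obtain ⟨M, hM⟩ := exists_norm_le H hT hr hg
  refine intervalIntegral.continuous_of_dominated_interval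
    (bound := fun t => ‖a t‖ * M + ‖b t‖ * M) (fun lam => ?_) (fun lam => .of_forall fun t ht => ?_)
    (by fun_prop (disch := assumption) : ContinuousOn _ _).intervalIntegrable
    (.of_forall fun t ht => ?_)
  · exact ((ha.mul (H lam).fst.continuousOn).add
      (hb.mul (H lam).snd.continuousOn)).intervalIntegrable.def'.aestronglyMeasurable
  · obtain ⟨hu, hv⟩ := hM lam t (uIoc_subset_uIcc ht)
    refine (norm_add_le _ _).trans ?_
    rw [norm_mul, norm_mul]
    gcongr
  · obtain ⟨hu, hv⟩ := continuous_parameter_of_mem H hT hr hg (uIoc_subset_uIcc ht)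
    fun_prop

theorem continuous_couplingLog (H : ∀ lam, IsNormalizedSolution r g lam T (u lam) (v lam))
    (hT : 0 ≤ T) (hr : IntervalIntegrable r volume 0 T) (hg : IntervalIntegrable g volume 0 T) :
    Continuous fun lam => couplingLog g (u lam) (v lam) T := by
  refine intervalIntegral.continuous_of_dominated_interval (bound := fun t => ‖g t‖)
    (fun lam => ((H lam).intervalIntegrable_mul_ratio hg).def'.aestronglyMeasurable)
    (fun lam => .of_forall fun t ht => ?_) hg.norm (.of_forall fun t ht => ?_)
  · rw [norm_mul]
    exact mul_le_of_le_one_right (norm_nonneg _) ((H lam).norm_div_le_one (uIoc_subset_uIcc ht))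
  · obtain ⟨hu, hv⟩ := continuous_parameter_of_mem H hT hr hg (uIoc_subset_uIcc ht)
    exact continuous_const.mul
      (hv.div hu fun lam => (H lam).fst_ne_zero (uIoc_subset_uIcc ht))

theorem hasDerivAt_fst (H : ∀ lam, IsNormalizedSolution r g lam T (u lam) (v lam)) (hT : 0 ≤ T)
    (hr : IntervalIntegrable r volume 0 T) (hg : IntervalIntegrable g volume 0 T) (lam : ℝ) :
    HasDerivAt (fun lam => u lam T)
      (-Complex.I * (u lam T * hermitianMoment (u lam) (v lam) T
        - conj (v lam T) * bilinearMoment (u lam) (v lam) T)) lam := by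
  have hu := (H lam).fst.continuousOn
  have hv := (H lam).snd.continuousOn
  have hpair := hasDerivAt_sub_mul_of_continuousAt (continuous_integral_mul_add_mul H hT hr hg
    hu.star hv.star).continuousAt (x₀ := lam)
  have hwron := hasDerivAt_sub_mul_of_continuousAt (continuous_integral_mul_add_mul H hT hr hg
    hv hu).continuousAt (x₀ := lam)
  have hK : ∫ t in (0 : ℝ)..T, (star (u lam t) * u lam t + star (v lam t) * v lam t)
      = hermitianMoment (u lam) (v lam) T := by
    rw [hermitianMoment, ← intervalIntegral.integral_ofReal]
    refine intervalIntegral.integral_congr fun t _ => ?_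
    simp [← Complex.conj_mul']
  have hκ : ∫ t in (0 : ℝ)..T, (v lam t * u lam t + u lam t * v lam t)
      = bilinearMoment (u lam) (v lam) T :=
    intervalIntegral.integral_congr fun t _ => by ring
  rw [hK] at hpair
  rw [hκ] at hwron
  refine ((((hpair.const_mul Complex.I).const_sub 1).const_mul (u lam T)).add
    ((hwron.const_mul Complex.I).const_mul (conj (v lam T)))).congr_deriv (by ring)
    |>.congr_of_eventuallyEq (.of_forall fun lam' => ?_)
  simpa only [add_comm (v lam _ * _), Complex.star_def, Pi.add_apply] using
    ((H lam).eq_variation_of_parameters (H lam')).1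

end Family

end IsNormalizedSolution

theorem sq_hyperbolic {h j : ℝ} (hj : h ^ 2 - j ^ 2 = 1) (y B : ℝ) :
    (h * y - B * j) ^ 2 = (y ^ 2 - B ^ 2) + (y * j - h * B) ^ 2 := by
  linear_combination (y ^ 2 - B ^ 2) * hj

theorem hyperbolic_pos {h j y B : ℝ} (hh : 0 < h) (hj0 : 0 ≤ j) (hj : h ^ 2 - j ^ 2 = 1)
    (hy : 0 < y) (hB : B ≤ y) : 0 < h * y - B * j := by
  have hjh : j < h := lt_of_pow_lt_pow_left₀ 2 hh.le (by linarith)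
  linarith [mul_le_mul_of_nonneg_right hB hj0, mul_lt_mul_of_pos_right hjh hy]

theorem sqrt_le_hyperbolic {h j y B : ℝ} (hh : 0 < h) (hj0 : 0 ≤ j) (hj : h ^ 2 - j ^ 2 = 1)
    (hy : 0 < y) (hB : B ≤ y) : √(y ^ 2 - B ^ 2) ≤ h * y - B * j := by
  refine Real.sqrt_le_iff.2 ⟨(hyperbolic_pos hh hj0 hj hy hB).le, ?_⟩
  linarith [sq_hyperbolic hj y B, sq_nonneg (y * j - h * B)]

theorem sqrt_lt_hyperbolic {h j y B : ℝ} (hh : 0 < h) (hj0 : 0 ≤ j) (hj : h ^ 2 - j ^ 2 = 1)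
    (hy : 0 < y) (hB : B ≤ y) (hne : y * j ≠ h * B) : √(y ^ 2 - B ^ 2) < h * y - B * j := by
  refine (Real.sqrt_lt' (hyperbolic_pos hh hj0 hj hy hB)).2 ?_
  linarith [sq_hyperbolic hj y B, sq_pos_of_ne_zero (sub_ne_zero.2 hne)]

namespace IsNormalizedSolution

variable {lam : ℝ} {u v : ℝ → ℂ}

theorem sq_add_sq_norm_sub_sq (h : IsNormalizedSolution r g lam T u v) {x : ℝ}
    (hx : x ∈ uIcc 0 T) :
    (‖u x‖ ^ 2 + ‖v x‖ ^ 2) ^ 2 - (2 * (‖u x‖ * ‖v x‖)) ^ 2 = 1 := by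
  linear_combination (‖u x‖ ^ 2 - ‖v x‖ ^ 2 + 1) * h.norm_sq_sub_norm_sq hx

theorem sq_add_sq_norm_pos (h : IsNormalizedSolution r g lam T u v) {x : ℝ} (hx : x ∈ uIcc 0 T) :
    0 < ‖u x‖ ^ 2 + ‖v x‖ ^ 2 := by
  have := h.one_le_norm_fst hx
  positivity

theorem exists_sqrt_lt_hyperbolic (h : IsNormalizedSolution r g lam T u v)
    (hv : ∃ x ∈ uIcc 0 T, v x ≠ 0) {y B : ℝ} (hy : 0 < y) (hB : B ≤ y) :
    ∃ x ∈ uIcc 0 T, √(y ^ 2 - B ^ 2)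
      < (‖u x‖ ^ 2 + ‖v x‖ ^ 2) * y - B * (2 * (‖u x‖ * ‖v x‖)) := by
  suffices ∃ x ∈ uIcc 0 T, y * (2 * (‖u x‖ * ‖v x‖)) ≠ (‖u x‖ ^ 2 + ‖v x‖ ^ 2) * B by
    obtain ⟨x, hx, hne⟩ := this
    exact ⟨x, hx, sqrt_lt_hyperbolic (h.sq_add_sq_norm_pos hx) (by positivity)
      (h.sq_add_sq_norm_sub_sq hx) hy hB hne⟩
  rcases eq_or_ne B 0 with rfl | hB0
  · obtain ⟨x, hx, hvx⟩ := hv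
    exact ⟨x, hx, by simp [hy.ne', hvx, h.fst_ne_zero hx]⟩
  · exact ⟨0, left_mem_uIcc, by simpa [h.fst_zero, h.snd_zero] using hB0.symm⟩

theorem mul_sqrt_lt_moments (h : IsNormalizedSolution r g lam T u v) (hT : 0 < T)
    (hv : ∃ x ∈ uIcc 0 T, v x ≠ 0) {y B : ℝ} (hy : 0 < y) (hB0 : 0 ≤ B) (hB : B ≤ y) :
    T * √(y ^ 2 - B ^ 2) < hermitianMoment u v T * y - B * ‖bilinearMoment u v T‖ := by
  have hu' := h.fst.continuousOn.norm
  have hv' := h.snd.continuousOn.norm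
  set speed : ℝ → ℝ := fun x => (‖u x‖ ^ 2 + ‖v x‖ ^ 2) * y - B * (2 * (‖u x‖ * ‖v x‖))
    with hspeed
  have hcont : ContinuousOn speed (uIcc 0 T) := by fun_prop
  have hle : ∀ x ∈ uIcc 0 T, √(y ^ 2 - B ^ 2) ≤ speed x := fun x hx =>
    sqrt_le_hyperbolic (h.sq_add_sq_norm_pos hx) (by positivity) (h.sq_add_sq_norm_sub_sq hx) hy hB
  obtain ⟨c, hc, hlt⟩ := h.exists_sqrt_lt_hyperbolic hv hy hB
  have hmoment : ‖bilinearMoment u v T‖ ≤ ∫ t in (0 : ℝ)..T, 2 * (‖u t‖ * ‖v t‖) := by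
    simpa [bilinearMoment] using intervalIntegral.norm_integral_le_integral_norm
      (f := fun t => 2 * (u t * v t)) (μ := volume) hT.le
  rw [uIcc_of_le hT.le] at hle hc
  calc T * √(y ^ 2 - B ^ 2) = ∫ _ in (0 : ℝ)..T, √(y ^ 2 - B ^ 2) := by simp
    _ < ∫ t in (0 : ℝ)..T, speed t :=
        intervalIntegral.integral_lt_integral_of_continuousOn_of_le_of_exists_lt hT
          continuousOn_const (uIcc_of_le hT.le ▸ hcont)
          (fun x hx => hle x (Ioc_subset_Icc_self hx)) ⟨c, hc, hlt⟩
    _ = hermitianMoment u v T * y - B * ∫ t in (0 : ℝ)..T, 2 * (‖u t‖ * ‖v t‖) := by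
        rw [hspeed, intervalIntegral.integral_sub, intervalIntegral.integral_mul_const,
          intervalIntegral.integral_const_mul, hermitianMoment]
        · exact ContinuousOn.intervalIntegrable (by fun_prop)
        · exact ContinuousOn.intervalIntegrable (by fun_prop)
    _ ≤ hermitianMoment u v T * y - B * ‖bilinearMoment u v T‖ := by gcongr

theorem coupling_ae_eq_zero (h : IsNormalizedSolution r g lam T u v)
    (hv : ∀ x ∈ uIcc 0 T, v x = 0) : ∀ᵐ x, x ∈ Ioo 0 T → g x = 0 := by
  filter_upwards [h.snd.hasDerivAt] with x hderiv hx
  have hsub : Ioo 0 T ⊆ uIcc 0 T := Ioo_subset_Icc_self.trans Icc_subset_uIcc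
  have hzero : HasDerivAt v 0 x := by
    refine (hasDerivAt_const x (0 : ℂ)).congr_of_eventuallyEq ?_
    filter_upwards [Ioo_mem_nhds hx.1 hx.2] with z hz using hv z (hsub hz)
  simpa [hv x (hsub hx), h.fst_ne_zero (hsub hx)] using (hderiv (hsub hx)).unique hzero

end IsNormalizedSolution

/-- The continuous branch `freePhase - Im couplingLog` of `-arg u`. -/
noncomputable def phase (r : ℝ → ℝ) (g : ℝ → ℂ) (lam : ℝ) (u v : ℝ → ℂ) (x : ℝ) : ℝ :=
  freePhase r lam x - (couplingLog g u v x).im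

theorem hasDerivAt_of_hasDerivAt_exp {Λ : ℝ → ℂ} {A' : ℂ} {x₀ : ℝ} (hΛ : ContinuousAt Λ x₀)
    (hexp : HasDerivAt (fun x => Complex.exp (Λ x)) A' x₀) :
    HasDerivAt Λ (A' / Complex.exp (Λ x₀)) x₀ := by
  have hlog : HasDerivAt (fun x => Complex.log (Complex.exp (Λ x - Λ x₀)))
      (A' / Complex.exp (Λ x₀)) x₀ := by
    simp only [Complex.exp_sub]
    simpa using (hexp.div_const (Complex.exp (Λ x₀))).clog_real (by simp)
  refine (hlog.const_add (Λ x₀)).congr_of_eventuallyEq ?_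
  have him : ∀ᶠ x in 𝓝 x₀, (Λ x - Λ x₀).im ∈ Ioo (-Real.pi) Real.pi :=
    (Complex.continuous_im.continuousAt.comp (hΛ.sub continuousAt_const)).eventually_mem
      (Ioo_mem_nhds (by simp [Real.pi_pos]) (by simp [Real.pi_pos]))
  filter_upwards [him] with x hx
  rw [Complex.log_exp hx.1 hx.2.le]
  ring

namespace IsNormalizedSolution

variable {lam : ℝ} {u v : ℝ → ℂ}

theorem re_fst (h : IsNormalizedSolution r g lam T u v) (hr : IntervalIntegrable r volume 0 T)
    (hg : IntervalIntegrable g volume 0 T) :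
    (u T).re = ‖u T‖ * Real.cos (phase r g lam u v T) := by
  rw [← h.exp_couplingLog_sub_freePhase hr hg right_mem_uIcc, Complex.norm_exp, Complex.exp_re,
    ← Real.cos_neg (phase r g lam u v T)]
  simp [phase]

theorem im_fst (h : IsNormalizedSolution r g lam T u v) (hr : IntervalIntegrable r volume 0 T)
    (hg : IntervalIntegrable g volume 0 T) :
    (u T).im = -(‖u T‖ * Real.sin (phase r g lam u v T)) := by
  rw [← h.exp_couplingLog_sub_freePhase hr hg right_mem_uIcc, Complex.norm_exp, Complex.exp_im,
    ← mul_neg, ← Real.sin_neg (phase r g lam u v T)]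
  simp [phase]

theorem phase_speed_pos (h : IsNormalizedSolution r g lam T u v) (hT : 0 < T)
    (hv : ∃ x ∈ uIcc 0 T, v x ≠ 0) :
    0 < hermitianMoment u v T - (conj (v T) * bilinearMoment u v T / u T).re := by
  have hmom := h.mul_sqrt_lt_moments hT hv one_pos zero_le_one le_rfl
  have hratio : (conj (v T) * bilinearMoment u v T / u T).re ≤ ‖bilinearMoment u v T‖ := by
    refine (Complex.re_le_norm _).trans ?_
    rw [mul_div_right_comm, norm_mul, norm_div, Complex.norm_conj, ← norm_div]
    exact mul_le_of_le_one_left (norm_nonneg _) (h.norm_div_le_one right_mem_uIcc)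
  simp only [one_pow, sub_self, Real.sqrt_zero, mul_zero, mul_one, one_mul] at hmom
  linarith

theorem re_speed (h : IsNormalizedSolution r g lam T u v) (hT : 0 < T)
    (hv : ∃ x ∈ uIcc 0 T, v x ≠ 0) (hre : |(u T).re| ≤ 1) (him : (u T).im ≠ 0) :
    0 < (hermitianMoment u v T * (u T).im - (conj (v T) * bilinearMoment u v T).im) * (u T).im ∧
      T * √(1 - (u T).re ^ 2)
        < |hermitianMoment u v T * (u T).im - (conj (v T) * bilinearMoment u v T).im| := by
  have hid : |(u T).im| ^ 2 - ‖v T‖ ^ 2 = 1 - (u T).re ^ 2 := by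
    rw [← h.norm_sq_sub_norm_sq right_mem_uIcc, Complex.sq_norm (u T), Complex.normSq_apply,
      sq_abs]
    ring
  have hB : ‖v T‖ ≤ |(u T).im| :=
    le_of_sq_le_sq (by linarith [(sq_le_one_iff_abs_le_one _).2 hre]) (abs_nonneg _)
  have hmom := h.mul_sqrt_lt_moments hT hv (abs_pos.2 him) (norm_nonneg _) hB
  have herr : |(conj (v T) * bilinearMoment u v T).im| ≤ ‖v T‖ * ‖bilinearMoment u v T‖ := by
    simpa using Complex.abs_im_le_norm (conj (v T) * bilinearMoment u v T)
  rw [hid] at hmom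
  have hnonneg : 0 ≤ T * √(1 - (u T).re ^ 2) := by positivity
  rw [abs_le] at herr
  rcases him.lt_or_gt with him | him
  · rw [abs_of_neg him] at hmom
    have hneg : hermitianMoment u v T * (u T).im - (conj (v T) * bilinearMoment u v T).im < 0 := by
      linarith
    exact ⟨mul_pos_of_neg_of_neg hneg him, by rw [abs_of_neg hneg]; linarith⟩
  · rw [abs_of_pos him] at hmom
    have hpos : 0 < hermitianMoment u v T * (u T).im
        - (conj (v T) * bilinearMoment u v T).im := by linarith
    exact ⟨mul_pos hpos him, by rw [abs_of_pos hpos]; linarith⟩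

section Family

variable {u v : ℝ → ℝ → ℂ}

theorem hasDerivAt_re_fst (H : ∀ lam, IsNormalizedSolution r g lam T (u lam) (v lam)) (hT : 0 ≤ T)
    (hr : IntervalIntegrable r volume 0 T) (hg : IntervalIntegrable g volume 0 T) (lam : ℝ) :
    HasDerivAt (fun lam => (u lam T).re)
      (hermitianMoment (u lam) (v lam) T * (u lam T).im
        - (conj (v lam T) * bilinearMoment (u lam) (v lam) T).im) lam := by
  refine (Complex.reCLM.hasFDerivAt.comp_hasDerivAt lam (hasDerivAt_fst H hT hr hg lam)).congr_deriv
    ?_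
  simp only [Complex.reCLM_apply, neg_mul, Complex.neg_re, Complex.I_mul_re, neg_neg,
    Complex.sub_im, Complex.im_mul_ofReal, mul_comm]

theorem hasDerivAt_phase (H : ∀ lam, IsNormalizedSolution r g lam T (u lam) (v lam)) (hT : 0 ≤ T)
    (hr : IntervalIntegrable r volume 0 T) (hg : IntervalIntegrable g volume 0 T) (lam : ℝ) :
    HasDerivAt (fun lam => phase r g lam (u lam) (v lam) T)
      (hermitianMoment (u lam) (v lam) T
        - (conj (v lam T) * bilinearMoment (u lam) (v lam) T / u lam T).re) lam := by
  have hexp := fun lam => (H lam).exp_couplingLog_sub_freePhase hr hg right_mem_uIcc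
  have hfree : Continuous fun lam => freePhase r lam T := by
    unfold freePhase
    fun_prop
  have hlog := hasDerivAt_of_hasDerivAt_exp
    (Λ := fun lam => couplingLog g (u lam) (v lam) T - Complex.I * freePhase r lam T)
    ((continuous_couplingLog H hT hr hg).sub (by fun_prop)).continuousAt
    (by simpa only [hexp] using hasDerivAt_fst H hT hr hg lam)
  have hu := (H lam).fst_ne_zero right_mem_uIcc
  have hquot : -Complex.I * (u lam T * hermitianMoment (u lam) (v lam) T
        - conj (v lam T) * bilinearMoment (u lam) (v lam) T) / u lam T
      = -(Complex.I * (hermitianMoment (u lam) (v lam) T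
        - conj (v lam T) * bilinearMoment (u lam) (v lam) T / u lam T)) := by
    field_simp
  rw [hexp, hquot] at hlog
  refine (Complex.imCLM.hasFDerivAt.comp_hasDerivAt lam hlog).neg.congr_of_eventuallyEq
    (.of_forall fun lam => ?_) |>.congr_deriv ?_
  · simp [phase]
  · simp

theorem tendsto_phase_sub_cocompact
    (H : ∀ lam, IsNormalizedSolution r g lam T (u lam) (v lam)) (hT : 0 ≤ T)
    (hr : IntervalIntegrable r volume 0 T) (hg : IntervalIntegrable g volume 0 T) :
    Tendsto (fun lam => phase r g lam (u lam) (v lam) T - (T * lam - ∫ t in (0 : ℝ)..T, r t))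
      (cocompact ℝ) (𝓝 0) := by
  have him := ((Complex.continuous_im.tendsto 0).comp
    (tendsto_couplingLog_cocompact H hT hr hg)).neg
  rw [Complex.zero_im, neg_zero] at him
  refine him.congr fun lam => ?_
  simp only [Function.comp_apply, phase, freePhase]
  ring

theorem coupling_ae_eq_zero_of_abs_re_le_one
    (H : ∀ lam, IsNormalizedSolution r g lam T (u lam) (v lam)) (hT : 0 < T)
    (hr : IntervalIntegrable r volume 0 T) (hg : IntervalIntegrable g volume 0 T)
    (hle : ∀ lam, |(u lam T).re| ≤ 1) : ∀ᵐ x, x ∈ Ioo 0 T → g x = 0 := by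
  by_contra hne
  have hv : ∀ lam, ∃ x ∈ uIcc 0 T, v lam x ≠ 0 := fun lam => by
    by_contra! hzero
    exact hne ((H lam).coupling_ae_eq_zero hzero)
  have hphase := hasDerivAt_phase H hT.le hr hg
  have hlim := tendsto_phase_sub_cocompact H hT.le hr hg
  obtain ⟨lam, hlam⟩ := exists_one_lt_abs_of_phase_asymptotic hT
    (hasDerivAt_re_fst H hT.le hr hg) (fun lam => (H lam).re_fst hr hg)
    (fun lam => (H lam).one_le_norm_fst right_mem_uIcc)
    (strictMono_of_hasDerivAt_pos hphase fun lam => (H lam).phase_speed_pos hT (hv lam))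
    (continuous_iff_continuousAt.2 fun lam => (hphase lam).continuousAt)
    (hlim.mono_left atTop_le_cocompact) (hlim.mono_left atBot_le_cocompact)
    fun lam hre hsin => by
      have hu := norm_pos_iff.2 ((H lam).fst_ne_zero right_mem_uIcc)
      have him := (H lam).im_fst hr hg
      obtain ⟨hsign, hspeed⟩ := (H lam).re_speed hT (hv lam) hre
        (him ▸ neg_ne_zero.2 (mul_ne_zero hu.ne' hsin))
      refine ⟨neg_of_mul_neg_right (a := ‖u lam T‖) ?_ hu.le, hspeed⟩
      linear_combination hsign + (hermitianMoment (u lam) (v lam) T * (u lam T).im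
        - (conj (v lam T) * bilinearMoment (u lam) (v lam) T).im) * him
  exact (hle lam).not_gt hlam

end Family

end IsNormalizedSolution

section Reduction

variable {M : Matrix (Fin 2) (Fin 2) ℂ} {Q Y : ℝ → Matrix (Fin 2) (Fin 2) ℂ} {lam : ℝ}

/-- The coefficient of `σ₀` of a Hermitian matrix. -/
noncomputable def sigma0Part (M : Matrix (Fin 2) (Fin 2) ℂ) : ℝ := ((M 0 0).re + (M 1 1).re) / 2

/-- The coefficient of `σ₂` of a Hermitian matrix. -/
def sigma2Part (M : Matrix (Fin 2) (Fin 2) ℂ) : ℝ := (M 0 1).im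

/-- The traceless real symmetric part `!![b, a; a, -b]` of a Hermitian matrix, encoded as the
complex number `a + i b`. -/
noncomputable def symmetricPart (M : Matrix (Fin 2) (Fin 2) ℂ) : ℂ :=
  ⟨(M 0 1).re, ((M 0 0).re - (M 1 1).re) / 2⟩

theorem entries_of_isHermitian (hM : M.IsHermitian) :
    M 0 0 = sigma0Part M + (symmetricPart M).im ∧
      M 0 1 = (symmetricPart M).re + sigma2Part M * Complex.I ∧
      M 1 0 = (symmetricPart M).re - sigma2Part M * Complex.I ∧
      M 1 1 = sigma0Part M - (symmetricPart M).im := by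
  have hdiag : ∀ i, (M i i).im = 0 := fun i => Complex.conj_eq_iff_im.1 (hM.apply i i)
  have hoff : M 1 0 = conj (M 0 1) := (hM.apply 1 0).symm
  refine ⟨?_, ?_, ?_, ?_⟩ <;> apply Complex.ext <;>
    simp [sigma0Part, sigma2Part, symmetricPart, hdiag, hoff] <;> ring

theorem eq_smul_sigma0_add_smul_sigma2 (hM : M.IsHermitian) (h : symmetricPart M = 0) :
    M = (sigma0Part M : ℂ) • sigma0 + (sigma2Part M : ℂ) • sigma2 := by
  obtain ⟨h₀₀, h₀₁, h₁₀, h₁₁⟩ := entries_of_isHermitian hM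
  rw [h] at h₀₀ h₀₁ h₁₀ h₁₁
  ext i j
  fin_cases i <;> fin_cases j <;> simp [sigma0, sigma2, h₀₀, h₀₁, h₁₀, h₁₁]

section Integrable

variable {μ : Measure ℝ}

theorem integrable_sigma0Part (hQ : ∀ i j, Integrable (fun x => Q x i j) μ) :
    Integrable (fun x => sigma0Part (Q x)) μ :=
  ((hQ 0 0).re.add (hQ 1 1).re).div_const 2

theorem integrable_sigma2Part (hQ : ∀ i j, Integrable (fun x => Q x i j) μ) :
    Integrable (fun x => sigma2Part (Q x)) μ :=
  (hQ 0 1).im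

theorem integrable_symmetricPart (hQ : ∀ i j, Integrable (fun x => Q x i j) μ) :
    Integrable (fun x => symmetricPart (Q x)) μ := by
  refine ((hQ 0 1).re.ofReal.add
    ((((hQ 0 0).re.sub (hQ 1 1).re).div_const 2).ofReal.mul_const Complex.I)).congr
    (.of_forall fun x => ?_)
  apply Complex.ext <;> simp [symmetricPart]

theorem intervalIntegrable_sigma0Part {a b : ℝ}
    (hQ : ∀ i j, IntervalIntegrable (fun x => Q x i j) volume a b) :
    IntervalIntegrable (fun x => sigma0Part (Q x)) volume a b :=
  ⟨integrable_sigma0Part fun i j => (hQ i j).1, integrable_sigma0Part fun i j => (hQ i j).2⟩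

theorem intervalIntegrable_sigma2Part {a b : ℝ}
    (hQ : ∀ i j, IntervalIntegrable (fun x => Q x i j) volume a b) :
    IntervalIntegrable (fun x => sigma2Part (Q x)) volume a b :=
  ⟨integrable_sigma2Part fun i j => (hQ i j).1, integrable_sigma2Part fun i j => (hQ i j).2⟩

end Integrable

theorem symmetricPart_smul_sigma0_add_smul_sigma2 (r q : ℝ) :
    symmetricPart ((r : ℂ) • sigma0 + (q : ℂ) • sigma2) = 0 := by
  apply Complex.ext <;> simp [symmetricPart, sigma0, sigma2]

theorem J_mul_add_mul_eq_smul_iff {D M N : Matrix (Fin 2) (Fin 2) ℂ} {lam : ℂ} :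
    J * D + M * N = lam • N ↔ ∀ j,
      D 0 j = M 1 0 * N 0 j + M 1 1 * N 1 j - lam * N 1 j ∧
      D 1 j = lam * N 0 j - M 0 0 * N 0 j - M 0 1 * N 1 j := by
  rw [← Matrix.ext_iff, forall_comm]
  refine forall_congr' fun j => Fin.forall_fin_two.trans ?_
  simp only [J, Matrix.add_apply, Matrix.mul_apply, Fin.sum_univ_two, Matrix.smul_apply,
    smul_eq_mul, Matrix.of_apply, Matrix.cons_val', Matrix.cons_val_zero, Matrix.cons_val_one,
    Matrix.cons_val_fin_one]
  constructor <;> rintro ⟨h₀, h₁⟩ <;> constructor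
  · linear_combination -h₁
  · linear_combination h₀
  · linear_combination h₁
  · linear_combination -h₀

/-- The vector `(y₁, y₂)` solves `J y' + Q y = lam y` on `[0, T]`. -/
structure IsVectorSolution (Q : ℝ → Matrix (Fin 2) (Fin 2) ℂ) (lam T : ℝ) (y₁ y₂ : ℝ → ℂ) :
    Prop where
  fst : HasACDeriv y₁ (fun x => Q x 1 0 * y₁ x + Q x 1 1 * y₂ x - lam * y₂ x) 0 T
  snd : HasACDeriv y₂ (fun x => lam * y₁ x - Q x 0 0 * y₁ x - Q x 0 1 * y₂ x) 0 T

theorem IsFundamentalMatrix.isVectorSolution (hY : IsFundamentalMatrix Q lam Y) (k₀ k₁ : ℂ) :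
    IsVectorSolution Q lam T (fun x => k₀ * Y x 0 0 + k₁ * Y x 0 1)
      (fun x => k₀ * Y x 1 0 + k₁ * Y x 1 1) := by
  have hentry := fun i j => hasACDeriv_deriv (hY.absolutelyContinuous i j 0 T)
  constructor
  · refine (((hentry 0 0).const_mul k₀).add ((hentry 0 1).const_mul k₁)).congr_deriv ?_
    filter_upwards [hY.equation] with x hx _
    have hx := J_mul_add_mul_eq_smul_iff.1 hx
    simp only [Matrix.of_apply] at hx
    linear_combination k₀ * (hx 0).1 + k₁ * (hx 1).1
  · refine (((hentry 1 0).const_mul k₀).add ((hentry 1 1).const_mul k₁)).congr_deriv ?_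
    filter_upwards [hY.equation] with x hx _
    have hx := J_mul_add_mul_eq_smul_iff.1 hx
    simp only [Matrix.of_apply] at hx
    linear_combination k₀ * (hx 0).2 + k₁ * (hx 1).2

/-- The gauge factor `exp (i ∫₀ˣ q)`, which removes the coefficient `q` of `σ₂` from the
system. -/
noncomputable def gauge (q : ℝ → ℝ) (x : ℝ) : ℂ :=
  Complex.exp (Complex.I * ((∫ t in (0 : ℝ)..x, q t : ℝ) : ℂ))

theorem norm_gauge (q : ℝ → ℝ) (x : ℝ) : ‖gauge q x‖ = 1 :=
  Complex.norm_exp_I_mul_ofReal _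

theorem gauge_zero (q : ℝ → ℝ) : gauge q 0 = 1 := by
  simp [gauge]

theorem hasACDeriv_gauge {q : ℝ → ℝ} {a b : ℝ} (hq : IntervalIntegrable q volume a b)
    (h₀ : 0 ∈ uIcc a b) :
    HasACDeriv (gauge q) (fun x => gauge q x * (Complex.I * q x)) a b :=
  ((HasACDeriv.ofReal_intervalIntegral hq h₀).const_mul Complex.I).cexp

theorem IsVectorSolution.isSolution {y₁ y₂ : ℝ → ℂ} (hy : IsVectorSolution Q lam T y₁ y₂)
    (hherm : ∀ᵐ x, (Q x).IsHermitian)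
    (hq : IntervalIntegrable (fun x => sigma2Part (Q x)) volume 0 T) :
    IsSolution (fun x => sigma0Part (Q x)) (fun x => symmetricPart (Q x)) lam T
      (fun x => gauge (fun x => sigma2Part (Q x)) x * (y₁ x - Complex.I * y₂ x))
      (fun x => gauge (fun x => sigma2Part (Q x)) x * (y₁ x + Complex.I * y₂ x)) := by
  have hgauge := hasACDeriv_gauge hq left_mem_uIcc
  set G := gauge fun x => sigma2Part (Q x)
  constructor
  · refine (hgauge.mul (hy.fst.sub (hy.snd.const_mul Complex.I))).congr_deriv ?_
    filter_upwards [hherm] with x hx _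
    obtain ⟨h₀₀, h₀₁, h₁₀, h₁₁⟩ := entries_of_isHermitian hx
    have hg := Complex.re_add_im (symmetricPart (Q x))
    simp only [h₀₀, h₀₁, h₁₀, h₁₁]
    linear_combination G x * (y₁ x + Complex.I * y₂ x) * hg + G x * y₂ x *
      (sigma0Part (Q x) - lam - (symmetricPart (Q x)).im) * Complex.I_sq
  · refine (hgauge.mul (hy.fst.add (hy.snd.const_mul Complex.I))).congr_deriv ?_
    filter_upwards [hherm] with x hx _
    obtain ⟨h₀₀, h₀₁, h₁₀, h₁₁⟩ := entries_of_isHermitian hx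
    have hg : (symmetricPart (Q x)).re - (symmetricPart (Q x)).im * Complex.I
        = conj (symmetricPart (Q x)) := Complex.ext (by simp) (by simp)
    simp only [h₀₀, h₀₁, h₁₀, h₁₁]
    linear_combination G x * (y₁ x - Complex.I * y₂ x) * hg + G x * y₂ x *
      (sigma0Part (Q x) - lam - (symmetricPart (Q x)).im) * Complex.I_sq

theorem IsFundamentalMatrix.exists_isNormalizedSolution (hY : IsFundamentalMatrix Q lam Y)
    (hherm : ∀ᵐ x, (Q x).IsHermitian)
    (hq : IntervalIntegrable (fun x => sigma2Part (Q x)) volume 0 T) :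
    ∃ u v, IsNormalizedSolution (fun x => sigma0Part (Q x)) (fun x => symmetricPart (Q x))
      lam T u v ∧ ‖(Y T).trace‖ = 2 * |(u T).re| := by
  have hplus := (hY.isVectorSolution (1 / 2) (Complex.I / 2)).isSolution hherm hq
  have hminus := (hY.isVectorSolution (1 / 2) (-(Complex.I / 2))).isSolution hherm hq
  set G := gauge fun x => sigma2Part (Q x)
  have hG₀ : G 0 = 1 := gauge_zero _
  set u : ℝ → ℂ := fun x => G x * (1 / 2 * Y x 0 0 + Complex.I / 2 * Y x 0 1
    - Complex.I * (1 / 2 * Y x 1 0 + Complex.I / 2 * Y x 1 1))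
  set v : ℝ → ℂ := fun x => G x * (1 / 2 * Y x 0 0 + Complex.I / 2 * Y x 0 1
    + Complex.I * (1 / 2 * Y x 1 0 + Complex.I / 2 * Y x 1 1))
  have hu₀ : u 0 = 1 := by
    simp only [u, hG₀, hY.initial, Matrix.one_apply_eq,
      Matrix.one_apply_ne zero_ne_one, Matrix.one_apply_ne one_ne_zero]
    linear_combination (-1 / 2 : ℂ) * Complex.I_sq
  have hv₀ : v 0 = 0 := by
    simp only [v, hG₀, hY.initial, Matrix.one_apply_eq,
      Matrix.one_apply_ne zero_ne_one, Matrix.one_apply_ne one_ne_zero]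
    linear_combination (1 / 2 : ℂ) * Complex.I_sq
  have hnorm : IsNormalizedSolution _ _ lam T u v := ⟨hplus, hu₀, hv₀⟩
  have hconj : G T * (1 / 2 * Y T 0 0 + -(Complex.I / 2) * Y T 0 1
      + Complex.I * (1 / 2 * Y T 1 0 + -(Complex.I / 2) * Y T 1 1)) = conj (u T) := by
    have h := hnorm.snd_eq_of_isSolution hminus right_mem_uIcc
    simp only [hG₀, hY.initial, Matrix.one_apply_eq,
      Matrix.one_apply_ne zero_ne_one, Matrix.one_apply_ne one_ne_zero] at h
    linear_combination h + (v T - conj (u T)) / 2 * Complex.I_sq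
  refine ⟨u, v, hnorm, ?_⟩
  have htrace : G T * (Y T).trace = u T + conj (u T) := by
    rw [← hconj, Matrix.trace_fin_two]
    linear_combination G T * Y T 1 1 * Complex.I_sq
  calc ‖(Y T).trace‖ = ‖G T * (Y T).trace‖ := by rw [norm_mul, norm_gauge, one_mul]
    _ = 2 * |(u T).re| := by
      rw [htrace, Complex.add_conj, Complex.norm_real, Real.norm_eq_abs, abs_mul, abs_two]

theorem symmetricPart_ae_eq_zero (hT : 0 < T)
    (hQ : ∀ i j, IntervalIntegrable (fun x => Q x i j) volume 0 T)
    (hherm : ∀ᵐ x, (Q x).IsHermitian)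
    (hstable : ∀ lam : ℝ, ∃ Y, IsFundamentalMatrix Q lam Y ∧ ‖(Y T).trace‖ ≤ 2) :
    ∀ᵐ x, x ∈ Ioo 0 T → symmetricPart (Q x) = 0 := by
  choose Y hY hle using hstable
  choose u v H htrace using fun lam =>
    (hY lam).exists_isNormalizedSolution hherm (intervalIntegrable_sigma2Part hQ)
  exact IsNormalizedSolution.coupling_ae_eq_zero_of_abs_re_le_one H hT
    (intervalIntegrable_sigma0Part hQ)
    ⟨integrable_symmetricPart fun i j => (hQ i j).1, integrable_symmetricPart fun i j => (hQ i j).2⟩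
    fun lam => by linarith [htrace lam, hle lam]

end Reduction

section Periodicity

variable {X : Type*} {f : ℝ → X} {c : ℝ}

theorem ae_add_right {p : ℝ → Prop} (h : ∀ᵐ x, p x) (d : ℝ) : ∀ᵐ x, p (x + d) :=
  (measurePreserving_add_right volume d).quasiMeasurePreserving.ae h

theorem ae_forall_int_of_ae_periodic (h : ∀ᵐ x, f (x + c) = f x) :
    ∀ᵐ x, ∀ n : ℤ, f (x + n • c) = f x := by
  filter_upwards [ae_all_iff.2 fun n : ℤ => ae_add_right h (n • c)] with x hx n
  induction n using Int.induction_on with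
  | zero => simp
  | succ k ih => rw [add_smul, one_smul, ← add_assoc, hx, ih]
  | pred k ih => rw [← ih, ← hx, add_assoc, ← add_one_zsmul, sub_add_cancel]

theorem ae_of_ae_mem_Ioo_of_ae_periodic {p : X → Prop} (hc : 0 < c)
    (h : ∀ᵐ x, f (x + c) = f x) (hp : ∀ᵐ x, x ∈ Ioo 0 c → p (f x)) : ∀ᵐ x, p (f x) := by
  have hp' : ∀ᵐ x, x ∈ Ico 0 c → p (f x) := by
    filter_upwards [hp, Measure.ae_ne volume (0 : ℝ)] with x hx hne hmem
    exact hx ⟨lt_of_le_of_ne hmem.1 hne.symm, hmem.2⟩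
  filter_upwards [ae_forall_int_of_ae_periodic h,
    ae_all_iff.2 fun n : ℤ => ae_add_right hp' (n • c)] with x hper hx
  obtain ⟨n, hn, -⟩ := existsUnique_add_zsmul_mem_Ico hc x 0
  rw [zero_add] at hn
  exact hper n ▸ hx n hn

theorem intervalIntegrable_of_ae_periodic {E : Type*} [NormedAddCommGroup E] {f : ℝ → E}
    (hc : 0 < c) (h : ∀ᵐ x, f (x + c) = f x) (hf : IntervalIntegrable f volume 0 c) (a b : ℝ) :
    IntervalIntegrable f volume a b := by
  have hae : (fun x => f (toIcoMod hc 0 x)) =ᵐ[volume] f := by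
    filter_upwards [ae_forall_int_of_ae_periodic h] with x hx
    rw [← hx (-toIcoDiv hc 0 x), neg_smul, ← sub_eq_add_neg, toIcoMod]
  have hper : Function.Periodic (fun x => f (toIcoMod hc 0 x)) c := fun x => by
    simp only [toIcoMod_add_right]
  have hint := hper.intervalIntegrable₀ hc.ne' (hf.congr_ae (ae_restrict_of_ae hae.symm)) a b
  exact hint.congr_ae (ae_restrict_of_ae hae)

end Periodicity

theorem allInstabilityIntervalsVanish_iff {Q : ℝ → Matrix (Fin 2) (Fin 2) ℂ} :
    AllInstabilityIntervalsVanish Q ↔ ∀ lam : ℝ, ∃ Y, IsFundamentalMatrix Q lam Y ∧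
      ‖(Y Real.pi).trace‖ ≤ 2 := by
  have hmem : ∀ lam : ℝ, lam ∈ stabilitySet Q ↔ ∃ Y, IsFundamentalMatrix Q lam Y ∧
      ‖(Y Real.pi).trace‖ ≤ 2 := fun lam =>
    ⟨fun ⟨_, ⟨Y, hY, hd⟩, hle⟩ => ⟨Y, hY, hd ▸ hle⟩, fun ⟨Y, hY, hle⟩ => ⟨_, ⟨Y, hY, rfl⟩, hle⟩⟩
  simp only [← hmem, AllInstabilityIntervalsVanish, eq_empty_iff_forall_notMem]
  constructor
  · intro h lam
    by_contra hlam
    exact h _ ⟨lam, hlam, rfl⟩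
  · rintro h _ ⟨lam, hlam, -⟩
    exact hlam (h lam)

section ExplicitSolution

variable {Q Y Y' : ℝ → Matrix (Fin 2) (Fin 2) ℂ} {q : ℝ → ℝ}

theorem isFundamentalMatrix_of_hasACDeriv {lam : ℂ} (hinit : Y 0 = 1)
    (hY : ∀ i j (n : ℕ), HasACDeriv (fun x => Y x i j) (fun x => Y' x i j) (-n) n)
    (heq : ∀ᵐ x, J * Y' x + Q x * Y x = lam • Y x) : IsFundamentalMatrix Q lam Y where
  initial := hinit
  absolutelyContinuous i j a b := by
    obtain ⟨n, hn⟩ := exists_nat_ge (max |a| |b|)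
    have hmem : ∀ x : ℝ, |x| ≤ n → x ∈ uIcc (-n : ℝ) n := fun x hx =>
      Icc_subset_uIcc (abs_le.1 hx)
    exact (hY i j n).ac.mono (uIcc_subset_uIcc (hmem a ((le_max_left _ _).trans hn))
      (hmem b ((le_max_right _ _).trans hn)))
  equation := by
    filter_upwards [heq, ae_all_iff.2 fun i => ae_all_iff.2 fun j => ae_all_iff.2 fun n =>
      (hY i j n).hasDerivAt] with x hx hderiv
    obtain ⟨n, hn⟩ := exists_nat_ge |x|
    have hY' : (Matrix.of fun i j => deriv (fun t => Y t i j) x) = Y' x :=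
      Matrix.ext fun i j => (hderiv i j n (Icc_subset_uIcc (abs_le.1 hn))).deriv
    rw [hY', hx]

/-- The fundamental matrix of the system with potential `r σ₀ + q σ₂`: a rotation through the free
phase, times a unimodular scalar. -/
noncomputable def rotation (r q : ℝ → ℝ) (lam x : ℝ) : Matrix (Fin 2) (Fin 2) ℂ :=
  gauge (-q) x • !![Complex.cos (freePhase r lam x), -Complex.sin (freePhase r lam x);
    Complex.sin (freePhase r lam x), Complex.cos (freePhase r lam x)]

theorem norm_trace_rotation_le (r q : ℝ → ℝ) (lam x : ℝ) : ‖(rotation r q lam x).trace‖ ≤ 2 := by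
  rw [rotation, Matrix.trace_smul, norm_smul, norm_gauge, one_mul, Matrix.trace_fin_two_of,
    ← two_mul, ← Complex.ofReal_cos, norm_mul, Complex.norm_ofNat, Complex.norm_real]
  exact mul_le_of_le_one_right zero_le_two (Real.abs_cos_le_one _)

theorem hasACDeriv_rotation {a b : ℝ} (hr : IntervalIntegrable r volume a b)
    (hq : IntervalIntegrable q volume a b) (h₀ : 0 ∈ uIcc a b) (lam : ℝ) (i j : Fin 2) :
    HasACDeriv (fun x => rotation r q lam x i j)
      (fun x => ((r x - lam : ℂ) • (J * rotation r q lam x)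
        - (Complex.I * q x) • rotation r q lam x) i j) a b := by
  have hgauge := hasACDeriv_gauge hq.neg h₀
  have hphase := hasACDeriv_freePhase hr h₀ lam
  have hcos := hgauge.mul <|
    hphase.comp isOpen_univ (fun z _ => Complex.hasDerivAt_cos z) (mapsTo_univ _ _)
  have hsin := hgauge.mul <|
    hphase.comp isOpen_univ (fun z _ => Complex.hasDerivAt_sin z) (mapsTo_univ _ _)
  have hneg_sin := hgauge.mul <|
    hphase.comp isOpen_univ (fun z _ => (Complex.hasDerivAt_sin z).neg) (mapsTo_univ _ _)
  fin_cases i <;> fin_cases j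
  · refine hcos.congr_deriv (.of_forall fun x _ => ?_)
    simp [rotation, J]
    ring
  · refine hneg_sin.congr_deriv (.of_forall fun x _ => ?_)
    simp [rotation, J]
    ring
  · refine hsin.congr_deriv (.of_forall fun x _ => ?_)
    simp [rotation, J]
    ring
  · refine hcos.congr_deriv (.of_forall fun x _ => ?_)
    simp [rotation, J]
    ring

theorem isFundamentalMatrix_rotation (hr : ∀ a b, IntervalIntegrable r volume a b)
    (hq : ∀ a b, IntervalIntegrable q volume a b)
    (hQ : ∀ᵐ x, Q x = (r x : ℂ) • sigma0 + (q x : ℂ) • sigma2) (lam : ℝ) :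
    IsFundamentalMatrix Q lam (rotation r q lam) := by
  refine isFundamentalMatrix_of_hasACDeriv ?_
    (fun i j n => hasACDeriv_rotation (hr _ _) (hq _ _) (Icc_subset_uIcc (by simp)) lam i j) ?_
  · simp [rotation, gauge_zero, freePhase, Matrix.one_fin_two]
  · have hJ : J * J = -1 := by simp [J, Matrix.one_fin_two]
    have hsigma2 : sigma2 = Complex.I • J := by simp [sigma2, J]
    filter_upwards [hQ] with x hx
    rw [hx, sigma0, hsigma2, mul_sub, Matrix.mul_smul, Matrix.mul_smul, ← mul_assoc, hJ, add_mul,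
      smul_smul, Matrix.smul_mul, Matrix.smul_mul, neg_one_mul, one_mul]
    module

theorem exists_isFundamentalMatrix_norm_trace_le
    (hQ : ∀ i j a b, IntervalIntegrable (fun x => Q x i j) volume a b)
    (hherm : ∀ᵐ x, (Q x).IsHermitian) (hsym : ∀ᵐ x, symmetricPart (Q x) = 0) (lam T : ℝ) :
    ∃ Y, IsFundamentalMatrix Q lam Y ∧ ‖(Y T).trace‖ ≤ 2 :=
  ⟨_, isFundamentalMatrix_rotation
    (fun _ _ => intervalIntegrable_sigma0Part fun i j => hQ i j _ _)
    (fun _ _ => intervalIntegrable_sigma2Part fun i j => hQ i j _ _)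
    (by filter_upwards [hherm, hsym] with x using eq_smul_sigma0_add_smul_sigma2) lam,
    norm_trace_rotation_le ..⟩

end ExplicitSolution

end DiracSystem

theorem corollary5p4 (Q : ℝ → Matrix (Fin 2) (Fin 2) ℂ)
    (hherm : ∀ᵐ x : ℝ, (Q x).IsHermitian)
    (hper : ∀ᵐ x : ℝ, Q (x + Real.pi) = Q x)
    (hint : ∀ i j : Fin 2, IntegrableOn (fun x => Q x i j) (Set.Ico 0 Real.pi) volume) :
    DiracSystem.AllInstabilityIntervalsVanish Q ↔
      ∃ r q : ℝ → ℝ,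
        IntegrableOn r (Set.Ico 0 Real.pi) volume ∧
        IntegrableOn q (Set.Ico 0 Real.pi) volume ∧
        ∀ᵐ x : ℝ, Q x = (r x : ℂ) • DiracSystem.sigma0 + (q x : ℂ) • DiracSystem.sigma2 := by
  open DiracSystem in
  have hQ : ∀ i j a b, IntervalIntegrable (fun x => Q x i j) volume a b := fun i j =>
    intervalIntegrable_of_ae_periodic Real.pi_pos (hper.mono fun x hx => by rw [hx])
      ((intervalIntegrable_iff_integrableOn_Ico_of_le Real.pi_pos.le).2 (hint i j))
  rw [allInstabilityIntervalsVanish_iff]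
  constructor
  · intro hstable
    have hsym := symmetricPart_ae_eq_zero Real.pi_pos (fun i j => hQ i j _ _) hherm hstable
    refine ⟨_, _, integrable_sigma0Part hint, integrable_sigma2Part hint, ?_⟩
    filter_upwards [hherm, ae_of_ae_mem_Ioo_of_ae_periodic (p := fun M => symmetricPart M = 0)
      Real.pi_pos hper hsym] with x using eq_smul_sigma0_add_smul_sigma2
  · rintro ⟨r, q, -, -, hrq⟩ lam
    have hsym : ∀ᵐ x, symmetricPart (Q x) = 0 :=
      hrq.mono fun x hx => hx ▸ symmetricPart_smul_sigma0_add_smul_sigma2 (r x) (q x)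
    exact exists_isFundamentalMatrix_norm_trace_le hQ hherm hsym lam Real.pi
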